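/- Let $\dot{\mathbb R}=\mathbb R\setminus\{0\}$, $\lambda<0$ and $\nu=\sqrt{\tfrac14+\lambda}$ (principal root), so that $\nu$ is real if $-\tfrac14\le\lambda<0$ and purely imaginary if $\lambda<-\tfrac14$. Let $H^{(2)}_\nu$ be the Hankel function of the second kind, $\Theta$ the Heaviside step function, and $$G(t,x,y)=\frac{\Theta(xy)\sqrt{xy}}{4i^{\nu+1}t}\,e^{-\frac{x^2+y^2}{4it}}\,H^{(2)}_\nu\Big(\frac{xy}{2t}\Big),\qquad t>0,\ x,y\in\dot{\mathbb R}.$$ For $\alpha\in(0,\frac\pi2)$ and $h>0$ put $$D_{\alpha,h}=\{z\neq0:\operatorname{Arg}z\in[-\alpha,\alpha],\ \Im z\ge-h\}\cup\{z\neq0:\operatorname{Arg}z\in[\pi-\alpha,\pi+\alpha],\ \Im z\le h\}.$$ A function $f$ on an open interval $I$ belongs to $\mathrm{AC}(I)$ if $f(y)-f(x)=\int_x^y g(s)\,ds$, $x,y\in I$, for some $g\in L^1_{\mathrm{loc}}(I)$; $\mathrm{AC}(\dot{\mathbb R})$ consists of the functions that are in $\mathrm{AC}$ on both $(-\infty,0)$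 and $(0,\infty)$; and $\mathrm{AC}_{1,2}((0,T)\times\dot{\mathbb R})$ consists of the functions $\Psi$ with $\Psi(\cdot,x)\in\mathrm{AC}((0,T))$ for all $x\in\dot{\mathbb R}$ and $\Psi(t,\cdot),\Psi_x(t,\cdot)\in\mathrm{AC}(\dot{\mathbb R})$ for all $t\in(0,T)$. Then for all $T\in(0,\infty]$, $\alpha\in(0,\frac\pi2)$ and $h>0$, $G$ is a Green's function of the attractive centrifugal potential $V(t,x)=\lambda/x^2$ with Dirichlet conditions (transmission matrices $M=I$, $N=0$) in the following sense. $G$ has a continuation $G:(0,T)\times\dot{\mathbb R}\times D_{\alpha,h}\to\mathbb C$ such that $G(t,x,\cdot)$ is continuous on $D_{\alpha,h}$ and holomorphic on $\operatorname{int}D_{\alpha,h}$ for all $t\in(0,T)$, $x\in\dot{\mathbb R}$, and: (i) for every $z\in D_{\alpha,h}$, $G(\cdot,\cdot,z)\in\mathrm{AC}_{1,2}((0,T)\times\dot{\mathbb R})$ and $$i\,\partial_tG(t,x,z)=\Big(-\partial_x^2+\frac{\lambda}{x^2}\Big)G(t,x,z)\quad\text{for almost every }(t,x)\in(0,T)\times\dot{\mathbb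 R};$$ moreover $G(t,0^+,y)=G(t,0^-,y)=0$ for all $t\in(0,T)$, $y\in\dot{\mathbb R}$; and there is $a\in\mathrm{AC}((0,T))$ with $a(t)>0$ and $\lim_{t\to0^+}a(t)=\infty$ such that (ii) $\displaystyle\lim_{t\to0^+}\frac{G(t,x,x)}{\sqrt{a(t)}}=\frac1{\sqrt{i\pi}}$ for every $x\in\dot{\mathbb R}$; (iii) there are $p\in(0,2)$ and continuous functions $A_0,A_1,A_2,B_0,B_1,B_2:(0,T)\times\dot{\mathbb R}\to[0,\infty)$ such that the function $\widetilde G$ defined by $G(t,x,z)=e^{ia(t)(z-x)^2}\widetilde G(t,x,z)$ satisfies, for all $t\in(0,T)$, $x\in\dot{\mathbb R}$, $z\in D_{\alpha,h}$, $$|\widetilde G|\le A_0e^{B_0|z|^p},\qquad|\partial_x\widetilde G|\le A_1e^{B_1|z|^p},\qquad|\partial_x^2\widetilde G|,\ |\partial_t\widetilde G|\le A_2e^{B_2|z|^p},$$ with coefficients evaluated at $(t,x)$; for every $x\in\dot{\mathbb R}$ the functions $A_0(\cdot,x)/\sqrt{a}$ and $B_0(\cdot,x)$ are bounded as $t\to0^+$,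 and for every $t\in(0,T)$ the functions $A_0(t,\cdot)$ and $B_0(t,\cdot)$ are bounded as $x\to0^\pm$. -/

import Mathlib

open Filter Topology Set MeasureTheory

noncomputable section

namespace CentrifugalGreen

/-- The Bessel function of the first kind of complex order `ν`,
`J_ν(w) = ∑ₖ (-1)ᵏ / (k! Γ(ν + k + 1)) (w/2)^(2k+ν)`, on the principal branch
(`1/Γ` vanishes at the poles of `Γ`, as it does in Mathlib). -/
def besselJ (ν w : ℂ) : ℂ :=
  (w / 2) ^ ν * ∑' k : ℕ,
    ((-1 : ℂ) ^ k / ((k.factorial : ℂ) * Complex.Gamma (ν + k + 1))) * (w / 2) ^ (2 * k)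

/-- The quotient `(J_ν cos(πν) - J_{-ν}) / sin(πν)`, meaningful for non-integer `ν`. -/
def besselYQuot (ν w : ℂ) : ℂ :=
  (besselJ ν w * Complex.cos (Real.pi * ν) - besselJ (-ν) w) / Complex.sin (Real.pi * ν)

open Classical in
/-- The Bessel function of the second kind; for integer order the quotient is replaced by its
limiting value. -/
def besselY (ν w : ℂ) : ℂ :=
  if ∃ n : ℤ, ν = n then limUnder (𝓝[≠] ν) (fun μ : ℂ => besselYQuot μ w) else besselYQuot ν w

/-- The Hankel function of the second kind, `H_ν^{(2)} = J_ν - i Y_ν`. -/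
def hankelH2 (ν w : ℂ) : ℂ := besselJ ν w - Complex.I * besselY ν w

/-- The order `ν = √(1/4 + λ)` (principal square root). -/
def order (lam : ℝ) : ℂ := Complex.sqrt ((1 / 4 + lam : ℝ) : ℂ)

/-- The Heaviside step function. -/
def step (s : ℝ) : ℝ := if 0 < s then 1 else 0

/-- The kernel
`Θ(xy) √(xy) / (4 i^{ν+1} t) · exp(-(x² + y²)/(4 i t)) · H_ν^{(2)}(xy/(2t))`, `ν = √(1/4 + λ)`. -/
def greenFunction (lam : ℝ) (t x y : ℝ) : ℂ :=
  ((step (x * y) * Real.sqrt (x * y) : ℝ) : ℂ) / (4 * Complex.I ^ (order lam + 1) * t) *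
    Complex.exp (-((x : ℂ) ^ 2 + (y : ℂ) ^ 2) / (4 * Complex.I * t)) *
    hankelH2 (order lam) ((x : ℂ) * y / (2 * t))

/-- The domain `D_{α,h}`: `z ≠ 0` with `Arg z ∈ [-α, α]`, `Im z ≥ -h`, or with
`Arg z ∈ [π - α, π + α]`, i.e. `Arg (-z) ∈ [-α, α]`, and `Im z ≤ h`. -/
def domainD (α h : ℝ) : Set ℂ :=
  {z | z ≠ 0 ∧ Complex.arg z ∈ Icc (-α) α ∧ -h ≤ z.im} ∪
    {z | z ≠ 0 ∧ Complex.arg (-z) ∈ Icc (-α) α ∧ z.im ≤ h}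

/-- The time interval `(0, T)`, `T ∈ (0, ∞]`. -/
def timeInterval (T : EReal) : Set ℝ := {t | 0 < t ∧ (t : EReal) < T}

/-- Absolute continuity on an open interval `I`: `f` is a primitive of a locally integrable
function. -/
def AC {E : Type*} [NormedAddCommGroup E] [NormedSpace ℝ E] (f : ℝ → E) (I : Set ℝ) : Prop :=
  ∃ g : ℝ → E, LocallyIntegrableOn g I ∧ ∀ x ∈ I, ∀ y ∈ I, f y - f x = ∫ s in x..y, g s

/-- Absolute continuity on `ℝ \ {0}`, i.e. on both open half-lines. -/
def ACPunctured (f : ℝ → ℂ) : Prop := AC f (Iio 0) ∧ AC f (Ioi 0)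

/-- The space `AC_{1,2}((0,T) × (ℝ \ {0}))`. -/
def AC12 (T : EReal) (Ψ : ℝ → ℝ → ℂ) : Prop :=
  (∀ x : ℝ, x ≠ 0 → AC (fun t => Ψ t x) (timeInterval T)) ∧
  ∀ t ∈ timeInterval T, ACPunctured (Ψ t) ∧ ACPunctured (deriv (Ψ t))

/-- `i ∂ₜΨ = (-∂ₓ² + V) Ψ` for almost every `(t, x) ∈ (0,T) × (ℝ \ {0})`, where the derivatives
are required to exist. -/
def SolvesSchroedinger (T : EReal) (V Ψ : ℝ → ℝ → ℂ) : Prop :=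
  ∀ᵐ p : ℝ × ℝ, p.1 ∈ timeInterval T → p.2 ≠ 0 →
    DifferentiableAt ℝ (fun t => Ψ t p.2) p.1 ∧
    DifferentiableAt ℝ (Ψ p.1) p.2 ∧
    DifferentiableAt ℝ (deriv (Ψ p.1)) p.2 ∧
    Complex.I * deriv (fun t => Ψ t p.2) p.1 =
      -deriv (deriv (Ψ p.1)) p.2 + V p.1 p.2 * Ψ p.1 p.2

/-- The transmission condition `M (f(0⁺), f(0⁻)) = N (f'(0⁺), -f'(0⁻))`. One-sided limits of `f`
(of `f'`) have to exist as soon as they enter the condition, that is if `M ≠ 0` (if `N ≠ 0`). -/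
def Transmission (M N : Matrix (Fin 2) (Fin 2) ℂ) (f : ℝ → ℂ) : Prop :=
  ∃ fp fm dp dm : ℂ,
    (M ≠ 0 → Tendsto f (𝓝[>] 0) (𝓝 fp) ∧ Tendsto f (𝓝[<] 0) (𝓝 fm)) ∧
    (N ≠ 0 → Tendsto (deriv f) (𝓝[>] 0) (𝓝 dp) ∧ Tendsto (deriv f) (𝓝[<] 0) (𝓝 dm)) ∧
    M.mulVec ![fp, fm] = N.mulVec ![dp, -dm]

/-- The factor `G̃` in the decomposition `G(t,x,z) = e^{i a(t) (z-x)²} G̃(t,x,z)`. -/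
def reduced (a : ℝ → ℝ) (G : ℝ → ℝ → ℂ → ℂ) (t x : ℝ) (z : ℂ) : ℂ :=
  Complex.exp (-(Complex.I * a t * (z - x) ^ 2)) * G t x z

/-- A function of `(t, x)` is an admissible coefficient if it is nonnegative and continuous on
`(0,T) × (ℝ \ {0})`. -/
def IsCoefficient (T : EReal) (A : ℝ → ℝ → ℝ) : Prop :=
  (∀ t ∈ timeInterval T, ∀ x : ℝ, x ≠ 0 → 0 ≤ A t x) ∧
  ContinuousOn (fun p : ℝ × ℝ => A p.1 p.2) (timeInterval T ×ˢ {0}ᶜ)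

/-- The exponential bounds on `G̃` and its derivatives, for given `a` and exponent `p`, together
with the boundedness requirements on the coefficients as `t → 0⁺` and as `x → 0±`. -/
def ExponentialBounds (T : EReal) (M N : Matrix (Fin 2) (Fin 2) ℂ) (D : Set ℂ)
    (G : ℝ → ℝ → ℂ → ℂ) (a : ℝ → ℝ) (p : ℝ) : Prop :=
  ∃ A₀ A₁ A₂ B₀ B₁ B₂ : ℝ → ℝ → ℝ,
    (IsCoefficient T A₀ ∧ IsCoefficient T A₁ ∧ IsCoefficient T A₂ ∧
      IsCoefficient T B₀ ∧ IsCoefficient T B₁ ∧ IsCoefficient T B₂) ∧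
    (∀ t ∈ timeInterval T, ∀ x : ℝ, x ≠ 0 → ∀ z ∈ D,
      ‖reduced a G t x z‖ ≤ A₀ t x * Real.exp (B₀ t x * ‖z‖ ^ p) ∧
      ‖deriv (fun ξ => reduced a G t ξ z) x‖ ≤ A₁ t x * Real.exp (B₁ t x * ‖z‖ ^ p) ∧
      ‖deriv (deriv (fun ξ => reduced a G t ξ z)) x‖ ≤ A₂ t x * Real.exp (B₂ t x * ‖z‖ ^ p) ∧
      ‖deriv (fun τ => reduced a G τ x z) t‖ ≤ A₂ t x * Real.exp (B₂ t x * ‖z‖ ^ p)) ∧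
    (∀ x : ℝ, x ≠ 0 →
      IsBoundedUnder (· ≤ ·) (𝓝[>] 0) (fun t => A₀ t x / Real.sqrt (a t)) ∧
      IsBoundedUnder (· ≤ ·) (𝓝[>] 0) (fun t => B₀ t x)) ∧
    (∀ t ∈ timeInterval T,
      (M ≠ 0 ∨ N ≠ 0 →
        IsBoundedUnder (· ≤ ·) (𝓝[≠] 0) (A₀ t) ∧ IsBoundedUnder (· ≤ ·) (𝓝[≠] 0) (B₀ t)) ∧
      (N ≠ 0 →
        IsBoundedUnder (· ≤ ·) (𝓝[≠] 0) (A₁ t) ∧ IsBoundedUnder (· ≤ ·) (𝓝[≠] 0) (B₁ t)))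

/-- The properties required of a Green's function `G : (0,T) × (ℝ\{0}) × (ℝ\{0}) → ℂ` for the
potential `V` and the transmission matrices `M`, `N`, with continuation in the last variable to
`D ⊆ ℂ` and with the initial condition in the form `G(t,x,x)/√a(t) → 1/√(iπ)`. -/
def GreenAssumption (T : EReal) (V : ℝ → ℝ → ℂ) (M N : Matrix (Fin 2) (Fin 2) ℂ) (D : Set ℂ)
    (G : ℝ → ℝ → ℝ → ℂ) : Prop :=
  ∃ Gc : ℝ → ℝ → ℂ → ℂ,
    -- `Gc` continues `G`, is continuous on `D` and holomorphic in its interior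
    (∀ t ∈ timeInterval T, ∀ x : ℝ, x ≠ 0 →
      (∀ y : ℝ, y ≠ 0 → Gc t x y = G t x y) ∧
      ContinuousOn (Gc t x) D ∧ DifferentiableOn ℂ (Gc t x) (interior D)) ∧
    -- Schrödinger equation
    (∀ z ∈ D, AC12 T (fun t x => Gc t x z) ∧ SolvesSchroedinger T V (fun t x => Gc t x z)) ∧
    -- transmission condition
    (∀ y : ℝ, y ≠ 0 → ∀ t ∈ timeInterval T, Transmission M N (fun x => G t x y)) ∧
    ∃ a : ℝ → ℝ,
      AC a (timeInterval T) ∧ (∀ t ∈ timeInterval T, 0 < a t) ∧ Tendsto a (𝓝[>] 0) atTop ∧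
      -- initial condition
      (∀ x : ℝ, x ≠ 0 →
        Tendsto (fun t => G t x x / (Real.sqrt (a t) : ℂ)) (𝓝[>] 0)
          (𝓝 (1 / Complex.sqrt (Complex.I * Real.pi)))) ∧
      -- exponential bounds
      ∃ p ∈ Ioo (0 : ℝ) 2, ExponentialBounds T M N D Gc a p

end CentrifugalGreen

end

noncomputable section

namespace CentrifugalGreen

/-! Write `k(s) = ∫₀^∞ e^{-u} u^q (1 + u/(2s))^q du` with `q = ν - 1/2`. The theorem rests on one
identity, `sqrt_mul_hankelH2`: for `w > 0`, `√w H_ν^{(2)}(w)` is a constant times `e^{-iw} k(iw)`.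
The factor `e^{-iw}` with `w = xy/(2t)` completes the square in the Gaussian, so that for `xy > 0`,
`G = e^{i(y-x)²/(4t)} · const · t^{-1/2} k(ixy/(2t))`. Thus `a(t) = 1/(4t)`, and `G̃` is the
remaining factor, which continues to complex `z` off the imaginary axis.

All required properties are then properties of `k`. Since `λ < 0`, `0 ≤ Re ν < 1/2`, hence `-1 < Re
q < 0`. The equation `k'' = 2k' + q(q+1) k/s²` with `q(q+1) = ν² - 1/4 = λ` is the Schrödinger
equation. As `s → 0` the integrand tends to `0` because `Re q < 0`, which is the Dirichlet
condition. As `s → i∞`, `k` tends to `Γ(ν + 1/2)`, which is the initial condition. On the sectors of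
`D`, `s = ixz/(2t)` satisfies `|Im s| ≥ cos α · |s|`; this bounds `k`, `s k'` and `s² k''`
uniformly, so the estimates hold with no exponential growth at all.

The identity itself is a connection formula. `e^{-s} k(s)` and multiples of `√s I_{±ν}(s)` solve the
same linear equation on the slit plane, so their Wronskians are constants
(`wronskian_decaying_growing`, `wronskian_growing_growing`). These are computed at `∞`, with the
growth of `I_ν` taken from Poisson's integral, and at `0`, from the power series. Solving for
`e^{-s} k(s)` and setting `s = iw` gives the Hankel function for `ν ≠ 0`; the case `ν = 0` follows
by continuity in the order. -/

/-! ### The Laplace-type integral: bounds and integrability. -/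

/-- The integral `∫₀^∞ e^{-u} u^q (1 + u/(2z))^b du`. For `b = q = ν - 1/2` it is, up to elementary
factors, the modified Bessel function `K_ν(z)`. -/
def laplaceInt (q b z : ℂ) : ℂ :=
  ∫ u in Ioi (0 : ℝ), (Real.exp (-u) : ℂ) * (u : ℂ) ^ q * (1 + u / (2 * z)) ^ b

/-- `1 + u/(2z)` stays at distance at least `c` from the origin for `u > 0`. -/
def RayBound (c : ℝ) (z : ℂ) : Prop := ∀ u : ℝ, 0 < u → c ≤ ‖1 + (u : ℂ) / (2 * z)‖

/-- `u/(2z)` is a positive multiple of the conjugate of `z`, so adding `1` preserves a nonzero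
imaginary part, and otherwise a positive real part. The principal power in the integrand therefore
never meets its cut. -/
lemma one_add_div_mem_slitPlane {z : ℂ} (hz : z ∈ Complex.slitPlane) {u : ℝ} (hu : 0 < u) :
    1 + (u : ℂ) / (2 * z) ∈ Complex.slitPlane := by
  have hz0 : z ≠ 0 := Complex.slitPlane_ne_zero hz
  have hn : 0 < Complex.normSq z := Complex.normSq_pos.2 hz0
  have h1 : (1 + (u : ℂ) / (2 * z)).re = 1 + u / 2 * (z.re / Complex.normSq z) := by
    rw [show (u : ℂ) / (2 * z) = ((u / 2 : ℝ) : ℂ) * z⁻¹ by push_cast; field_simp]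
    simp [Complex.inv_re]
  have h2 : (1 + (u : ℂ) / (2 * z)).im = - (u / 2 * (z.im / Complex.normSq z)) := by
    rw [show (u : ℂ) / (2 * z) = ((u / 2 : ℝ) : ℂ) * z⁻¹ by push_cast; field_simp]
    simp [Complex.inv_im, neg_div]
  rw [Complex.mem_slitPlane_iff, h1, h2]
  rcases Complex.mem_slitPlane_iff.1 hz with h | h
  · left; positivity
  · right
    have : u / 2 * (z.im / Complex.normSq z) ≠ 0 := by positivity
    simpa using this

lemma rayBound_one {z : ℂ} (hz : 0 ≤ z.re) (hz0 : z ≠ 0) : RayBound 1 z := by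
  intro u hu
  have hn : 0 < Complex.normSq z := Complex.normSq_pos.2 hz0
  have h1 : (1 + (u : ℂ) / (2 * z)).re = 1 + u / 2 * (z.re / Complex.normSq z) := by
    rw [show (u : ℂ) / (2 * z) = ((u / 2 : ℝ) : ℂ) * z⁻¹ by push_cast; field_simp]
    simp [Complex.inv_re]
  refine le_trans ?_ (Complex.re_le_norm _)
  rw [h1]
  have : 0 ≤ u / 2 * (z.re / Complex.normSq z) := by positivity
  linarith

/-- `1 + u/(2z) = (z + u/2)/z`, and a real shift leaves the imaginary part of the numerator
unchanged. This is how an opening angle becomes a uniform constant. -/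
lemma rayBound_of_im {c : ℝ} {z : ℂ} (hz0 : z ≠ 0) (h : c * ‖z‖ ≤ |z.im|) : RayBound c z := by
  intro u hu
  have h1 : 1 + (u : ℂ) / (2 * z) = (z + ((u / 2 : ℝ) : ℂ)) / z := by
    push_cast; field_simp
  rw [h1, norm_div, le_div_iff₀ (norm_pos_iff.2 hz0)]
  refine h.trans ?_
  have := Complex.abs_im_le_norm (z + ((u / 2 : ℝ) : ℂ))
  simpa using this

lemma eventually_rayBound {z : ℂ} (hz : z ∈ Complex.slitPlane) :
    ∃ c : ℝ, 0 < c ∧ ∀ᶠ w in 𝓝 z, RayBound c w := by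
  have hz0 : z ≠ 0 := Complex.slitPlane_ne_zero hz
  have hne : ∀ᶠ w in 𝓝 z, w ≠ 0 := isOpen_ne.mem_nhds hz0
  rcases Complex.mem_slitPlane_iff.1 hz with h | h
  · refine ⟨1, one_pos, ?_⟩
    filter_upwards [(isOpen_lt continuous_const Complex.continuous_re).mem_nhds h, hne] with w hw hw0
    exact rayBound_one (le_of_lt hw) hw0
  · have hzn : 0 < ‖z‖ := norm_pos_iff.2 hz0
    have him : 0 < |z.im| := abs_pos.2 h
    refine ⟨|z.im| / (2 * ‖z‖), by positivity, ?_⟩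
    have hlt : |z.im| / (2 * ‖z‖) * ‖z‖ < |z.im| := by
      have : |z.im| / (2 * ‖z‖) * ‖z‖ = |z.im| / 2 := by field_simp
      linarith
    have hopen : IsOpen {w : ℂ | |z.im| / (2 * ‖z‖) * ‖w‖ < |w.im|} :=
      isOpen_lt (by fun_prop) (Complex.continuous_im.abs)
    filter_upwards [hopen.mem_nhds hlt, hne] with w hw hw0
    exact rayBound_of_im hw0 (le_of_lt hw)

/-- The argument is at most `π` in modulus, so an imaginary part of the exponent costs only a
constant factor. This covers purely imaginary `ν`. -/
lemma norm_cpow_le_of_le_norm {c : ℝ} (hc : 0 < c) {p b : ℂ} (hp : c ≤ ‖p‖) (hb : b.re ≤ 0) :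
    ‖p ^ b‖ ≤ c ^ b.re * Real.exp (Real.pi * |b.im|) := by
  have hp0 : p ≠ 0 := norm_pos_iff.1 (hc.trans_le hp)
  rw [Complex.norm_cpow_of_ne_zero hp0, div_eq_mul_inv, ← Real.exp_neg]
  refine mul_le_mul (Real.rpow_le_rpow_of_nonpos hc hp hb) (Real.exp_le_exp.2 ?_)
    (Real.exp_pos _).le (by positivity)
  calc -(p.arg * b.im) ≤ |p.arg * b.im| := neg_le_abs _
    _ = |p.arg| * |b.im| := abs_mul _ _
    _ ≤ _ := mul_le_mul_of_nonneg_right (Complex.abs_arg_le_pi _) (abs_nonneg _)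

/-- The integrand of `laplaceInt`. -/
def laplaceIntegrand (q b z : ℂ) (u : ℝ) : ℂ :=
  (Real.exp (-u) : ℂ) * (u : ℂ) ^ q * (1 + u / (2 * z)) ^ b

lemma norm_laplaceIntegrand_le {c : ℝ} (hc : 0 < c) {q b z : ℂ} (hz : RayBound c z)
    (hb : b.re ≤ 0) {u : ℝ} (hu : 0 < u) :
    ‖laplaceIntegrand q b z u‖ ≤
      Real.exp (-u) * u ^ q.re * (c ^ b.re * Real.exp (Real.pi * |b.im|)) := by
  rw [laplaceIntegrand, norm_mul, norm_mul, Complex.norm_cpow_eq_rpow_re_of_pos hu,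
    Complex.norm_real, Real.norm_of_nonneg (Real.exp_pos _).le]
  exact mul_le_mul_of_nonneg_left (norm_cpow_le_of_le_norm hc (hz u hu) hb) (by positivity)

lemma integrableOn_exp_mul_rpow {r : ℝ} (hr : -1 < r) :
    IntegrableOn (fun u : ℝ => Real.exp (-u) * u ^ r) (Ioi 0) := by
  simpa using Real.GammaIntegral_convergent (s := r + 1) (by linarith)

lemma continuousOn_laplaceIntegrand (q b : ℂ) {z : ℂ} (hz : z ∈ Complex.slitPlane) :
    ContinuousOn (laplaceIntegrand q b z) (Ioi 0) := by
  intro u hu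
  apply ContinuousAt.continuousWithinAt
  unfold laplaceIntegrand
  refine (ContinuousAt.mul (by fun_prop) ?_).mul ?_
  · exact Complex.continuous_ofReal.continuousAt.cpow continuousAt_const
      (Complex.ofReal_mem_slitPlane.2 hu)
  · exact ContinuousAt.cpow (by fun_prop) continuousAt_const (one_add_div_mem_slitPlane hz hu)

lemma aestronglyMeasurable_laplaceIntegrand (q b : ℂ) {z : ℂ} (hz : z ∈ Complex.slitPlane) :
    AEStronglyMeasurable (laplaceIntegrand q b z) (volume.restrict (Ioi 0)) :=
  (continuousOn_laplaceIntegrand q b hz).aestronglyMeasurable measurableSet_Ioi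

lemma integrableOn_laplaceIntegrand {q b z : ℂ} (hq : -1 < q.re) (hb : b.re ≤ 0)
    (hz : z ∈ Complex.slitPlane) : IntegrableOn (laplaceIntegrand q b z) (Ioi 0) := by
  obtain ⟨c, hc, h⟩ := eventually_rayBound hz
  refine Integrable.mono' ((integrableOn_exp_mul_rpow hq).mul_const
    (c ^ b.re * Real.exp (Real.pi * |b.im|))) (aestronglyMeasurable_laplaceIntegrand q b hz) ?_
  filter_upwards [ae_restrict_mem measurableSet_Ioi] with u hu
  exact norm_laplaceIntegrand_le hc h.self_of_nhds hb hu

/-- The bound on `laplaceInt` that is uniform over `RayBound c`. -/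
def laplaceBound (q b : ℂ) (c : ℝ) : ℝ :=
  Real.Gamma (q.re + 1) * (c ^ b.re * Real.exp (Real.pi * |b.im|))

lemma norm_laplaceInt_le {c : ℝ} (hc : 0 < c) {q b z : ℂ} (hq : -1 < q.re) (hb : b.re ≤ 0)
    (hz : RayBound c z) : ‖laplaceInt q b z‖ ≤ laplaceBound q b c := by
  have h1 : laplaceBound q b c = ∫ u in Ioi (0 : ℝ),
      Real.exp (-u) * u ^ q.re * (c ^ b.re * Real.exp (Real.pi * |b.im|)) := by
    rw [integral_mul_const, laplaceBound, Real.Gamma_eq_integral (by linarith)]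
    simp
  rw [h1]
  refine norm_integral_le_of_norm_le ((integrableOn_exp_mul_rpow hq).mul_const _) ?_
  filter_upwards [ae_restrict_mem measurableSet_Ioi] with u hu
  exact norm_laplaceIntegrand_le hc hz hb hu

lemma laplaceBound_nonneg {q : ℂ} (hq : -1 < q.re) (b : ℂ) {c : ℝ} (hc : 0 < c) :
    0 ≤ laplaceBound q b c := by
  have : 0 < Real.Gamma (q.re + 1) := Real.Gamma_pos_of_pos (by linarith)
  unfold laplaceBound; positivity

/-! ### The differential equation of the Laplace-type integral. -/

lemma cpow_eq_cpow_sub_one_mul {p : ℂ} (hp : p ≠ 0) (b : ℂ) : p ^ b = p ^ (b - 1) * p := by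
  rw [Complex.cpow_sub _ _ hp, Complex.cpow_one, div_mul_cancel₀ _ hp]

/-- With `P = 1 + u/(2z)` one has `dP/dz = (1 - P)/z`, so differentiation only lowers the exponent
`b` and stays within the same family of integrals. -/
lemma hasDerivAt_laplaceIntegrand (q b : ℂ) {z : ℂ} (hz : z ∈ Complex.slitPlane) {u : ℝ}
    (hu : 0 < u) :
    HasDerivAt (fun w => laplaceIntegrand q b w u)
      (b / z * (laplaceIntegrand q (b - 1) z u - laplaceIntegrand q b z u)) z := by
  have hz0 : z ≠ 0 := Complex.slitPlane_ne_zero hz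
  have hP := one_add_div_mem_slitPlane hz hu
  have hP0 := Complex.slitPlane_ne_zero hP
  have h1 : HasDerivAt (fun w : ℂ => 1 + (u : ℂ) / (2 * w)) (-(u / (2 * z)) / z) z := by
    have := ((hasDerivAt_inv hz0).const_mul ((u : ℂ) / 2)).const_add 1
    refine (this.congr_deriv ?_).congr_of_eventuallyEq ?_
    · field_simp
    · filter_upwards [isOpen_ne.mem_nhds hz0] with w hw
      have : w ≠ 0 := hw
      field_simp
  have h2 := (h1.cpow_const (c := b) hP).const_mul ((Real.exp (-u) : ℂ) * (u : ℂ) ^ q)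
  refine h2.congr_deriv ?_
  have h3 := cpow_eq_cpow_sub_one_mul hP0 b
  simp only [laplaceIntegrand]
  rw [h3]
  ring

lemma hasDerivAt_laplaceInt {q b z : ℂ} (hq : -1 < q.re) (hb : b.re ≤ 0)
    (hz : z ∈ Complex.slitPlane) :
    HasDerivAt (laplaceInt q b) (b / z * (laplaceInt q (b - 1) z - laplaceInt q b z)) z := by
  obtain ⟨c, hc, h⟩ := eventually_rayBound hz
  have hz0 : z ≠ 0 := Complex.slitPlane_ne_zero hz
  have hzn : 0 < ‖z‖ := norm_pos_iff.2 hz0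
  have hb1 : (b - 1).re ≤ 0 := by simp; linarith
  have hfar : ∀ᶠ w in 𝓝 z, ‖z‖ / 2 < ‖w‖ :=
    (isOpen_lt continuous_const continuous_norm).mem_nhds (by simp only [mem_ofPred_eq]; linarith)
  obtain ⟨s, hs, hsub⟩ := (((h.and hfar).and (Complex.isOpen_slitPlane.mem_nhds hz))).exists_mem
  set C : ℝ := c ^ (b - 1).re * Real.exp (Real.pi * |(b - 1).im|) +
    c ^ b.re * Real.exp (Real.pi * |b.im|) with hC
  have key := hasDerivAt_integral_of_dominated_loc_of_deriv_le (𝕜 := ℂ)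
    (μ := volume.restrict (Ioi (0 : ℝ))) (F := fun w u => laplaceIntegrand q b w u)
    (F' := fun w u => b / w * (laplaceIntegrand q (b - 1) w u - laplaceIntegrand q b w u))
    (bound := fun u => Real.exp (-u) * u ^ q.re * (‖b‖ / (‖z‖ / 2) * C)) (x₀ := z) (s := s) hs
    ?_ (integrableOn_laplaceIntegrand hq hb hz) ?_ ?_ ?_ ?_
  · refine key.2.congr_deriv ?_
    rw [integral_const_mul, integral_sub (integrableOn_laplaceIntegrand hq hb1 hz)
      (integrableOn_laplaceIntegrand hq hb hz)]
    rfl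
  · filter_upwards [Complex.isOpen_slitPlane.mem_nhds hz] with w hw
    exact aestronglyMeasurable_laplaceIntegrand q b hw
  · exact ((aestronglyMeasurable_laplaceIntegrand q _ hz).sub
      (aestronglyMeasurable_laplaceIntegrand q b hz)).const_mul _
  · filter_upwards [ae_restrict_mem measurableSet_Ioi] with u hu w hw
    obtain ⟨⟨hw1, hw2⟩, hw3⟩ := hsub w hw
    have e1 := norm_laplaceIntegrand_le (q := q) hc hw1 hb1 hu
    have e2 := norm_laplaceIntegrand_le (q := q) hc hw1 hb hu
    rw [norm_mul, norm_div]
    calc ‖b‖ / ‖w‖ * ‖laplaceIntegrand q (b - 1) w u - laplaceIntegrand q b w u‖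
        ≤ ‖b‖ / (‖z‖ / 2) * (Real.exp (-u) * u ^ q.re * C) := by
          refine mul_le_mul (div_le_div_of_nonneg_left (norm_nonneg _) (by positivity) hw2.le) ?_
            (norm_nonneg _) (by positivity)
          refine (norm_sub_le _ _).trans ?_
          rw [hC, mul_add]
          exact add_le_add e1 e2
      _ = _ := by ring
  · exact (integrableOn_exp_mul_rpow hq).mul_const _
  · filter_upwards [ae_restrict_mem measurableSet_Ioi] with u hu w hw
    exact hasDerivAt_laplaceIntegrand q b (hsub w hw).2 hu

/-- The left side is the integral of the derivative of `e^{-u} u^{q+1} (1 + u/(2z))^{q-1}`, which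
vanishes at both ends. It is the relation that closes the second-order equation for `k`. -/
lemma laplaceInt_recurrence {q z : ℂ} (hq : -1 < q.re) (hq0 : q.re ≤ 0)
    (hz : z ∈ Complex.slitPlane) :
    -(2 * z) * (laplaceInt q q z - laplaceInt q (q - 1) z) + 2 * q * laplaceInt q (q - 1) z
      - (q - 1) * laplaceInt q (q - 2) z = 0 := by
  have hz0 : z ≠ 0 := Complex.slitPlane_ne_zero hz
  have hb1 : (q - 1).re ≤ 0 := by simp; linarith
  have hb2 : (q - 2).re ≤ 0 := by simp; linarith
  have i0 := integrableOn_laplaceIntegrand hq hq0 hz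
  have i1 := integrableOn_laplaceIntegrand hq hb1 hz
  have i2 := integrableOn_laplaceIntegrand hq hb2 hz
  set f : ℝ → ℂ := fun u => 2 * z * (laplaceIntegrand q q z u - laplaceIntegrand q (q - 1) z u)
    with hf
  set f' : ℝ → ℂ := fun u =>
    -(2 * z) * (laplaceIntegrand q q z u - laplaceIntegrand q (q - 1) z u)
      + 2 * q * laplaceIntegrand q (q - 1) z u - (q - 1) * laplaceIntegrand q (q - 2) z u with hf'
  have if' : IntegrableOn f' (Ioi 0) := (((i0.sub i1).const_mul _).add (i1.const_mul _)).sub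
    (i2.const_mul _)
  have if0 : IntegrableOn f (Ioi 0) := (i0.sub i1).const_mul _
  have hint : ∫ u in Ioi (0 : ℝ), f' u = -(2 * z) * (laplaceInt q q z - laplaceInt q (q - 1) z)
      + 2 * q * laplaceInt q (q - 1) z - (q - 1) * laplaceInt q (q - 2) z := by
    have i3 : IntegrableOn (fun u => laplaceIntegrand q q z u - laplaceIntegrand q (q - 1) z u)
      (Ioi 0) := i0.sub i1
    have i4 : IntegrableOn (fun u => -(2 * z) *
        (laplaceIntegrand q q z u - laplaceIntegrand q (q - 1) z u)
        + 2 * q * laplaceIntegrand q (q - 1) z u) (Ioi 0) :=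
      (i3.const_mul _).add (i1.const_mul _)
    simp only [hf']
    rw [integral_sub i4 (i2.const_mul _), integral_add (i3.const_mul _) (i1.const_mul _),
      integral_const_mul, integral_const_mul, integral_const_mul, integral_sub i0 i1]
    rfl
  -- the closed form of `f`, continuous up to `0`
  set g : ℝ → ℂ := fun u => (Real.exp (-u) : ℂ) * (u : ℂ) ^ (q + 1) * (1 + u / (2 * z)) ^ (q - 1)
    with hg
  have hfg : ∀ u ∈ Ioi (0 : ℝ), f u = g u := by
    intro u hu
    have hu0 : (u : ℂ) ≠ 0 := Complex.ofReal_ne_zero.2 (ne_of_gt hu)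
    have hP0 := Complex.slitPlane_ne_zero (one_add_div_mem_slitPlane hz hu)
    have h3 := cpow_eq_cpow_sub_one_mul hP0 q
    simp only [hf, hg, laplaceIntegrand]
    rw [h3, Complex.cpow_add _ _ hu0, Complex.cpow_one]
    field_simp
    ring
  have hderiv : ∀ u ∈ Ioi (0 : ℝ), HasDerivAt g (f' u) u := by
    intro u hu
    have hu0 : (u : ℂ) ≠ 0 := Complex.ofReal_ne_zero.2 (ne_of_gt hu)
    have hP := one_add_div_mem_slitPlane hz hu
    have hP0 := Complex.slitPlane_ne_zero hP
    have h3 : (1 + (u : ℂ) / (2 * z)) ^ q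
        = (1 + (u : ℂ) / (2 * z)) ^ (q - 2) * (1 + (u : ℂ) / (2 * z)) ^ 2 := by
      rw [Complex.cpow_sub _ _ hP0, Complex.cpow_ofNat, div_mul_cancel₀ _ (pow_ne_zero 2 hP0)]
    have h4 : (1 + (u : ℂ) / (2 * z)) ^ (q - 1)
        = (1 + (u : ℂ) / (2 * z)) ^ (q - 2) * (1 + (u : ℂ) / (2 * z)) := by
      rw [show q - 1 = q - 2 + 1 by ring, Complex.cpow_add _ _ hP0, Complex.cpow_one]
    have d1 : HasDerivAt (fun v : ℂ => Complex.exp (-v)) (Complex.exp (-(u : ℂ)) * -1) (u : ℂ) :=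
      (hasDerivAt_neg (u : ℂ)).cexp
    have d2 : HasDerivAt (fun v : ℂ => v ^ (q + 1)) ((q + 1) * (u : ℂ) ^ (q + 1 - 1) * 1) (u : ℂ) :=
      (hasDerivAt_id (u : ℂ)).cpow_const (Complex.ofReal_mem_slitPlane.2 hu)
    have d3 : HasDerivAt (fun v : ℂ => (1 + v / (2 * z)) ^ (q - 1))
        ((q - 1) * (1 + (u : ℂ) / (2 * z)) ^ (q - 1 - 1) * (1 / (2 * z))) (u : ℂ) :=
      (((hasDerivAt_id (u : ℂ)).div_const (2 * z)).const_add 1).cpow_const hP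
    have d := ((d1.mul d2).mul d3).comp_ofReal
    have hgeq : g = fun y : ℝ => (((fun v : ℂ => Complex.exp (-v)) * fun v : ℂ => v ^ (q + 1)) *
        fun v : ℂ => (1 + v / (2 * z)) ^ (q - 1)) (y : ℂ) := by
      funext y
      simp [hg]
    rw [hgeq]
    refine d.congr_deriv ?_
    simp only [hf', laplaceIntegrand, Pi.mul_apply]
    rw [show q - 1 - 1 = q - 2 by ring, h3, h4, show q + 1 - 1 = q by ring,
      Complex.cpow_add _ _ hu0, Complex.cpow_one]
    push_cast
    field_simp
    ring
  have hcont : ContinuousWithinAt g (Ici 0) 0 := by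
    apply ContinuousAt.continuousWithinAt
    refine (ContinuousAt.mul (by fun_prop) (Complex.continuousAt_ofReal_cpow_const 0 (q + 1)
      (Or.inl (by simp; linarith)))).mul ?_
    exact ContinuousAt.cpow (by fun_prop) continuousAt_const (by simp)
  have ig : IntegrableOn g (Ioi 0) := if0.congr_fun hfg measurableSet_Ioi
  -- Integrability of both `g` and its derivative replaces a direct estimate of `g` at infinity.
  have hlim := tendsto_zero_of_hasDerivAt_of_integrableOn_Ioi hderiv if' ig
  have := integral_Ioi_of_hasDerivAt_of_tendsto hcont hderiv if' hlim
  have hq1 : q + 1 ≠ 0 := fun h => by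
    have := congrArg Complex.re h
    simp at this; linarith
  rw [← hint, this]
  simp [hg, Complex.zero_cpow hq1]

/-- `k = laplaceInt q q` solves `k'' = 2 k' + q (q + 1) k / z²`. -/
lemma hasDerivAt_deriv_laplaceInt {q z : ℂ} (hq : -1 < q.re) (hq0 : q.re ≤ 0)
    (hz : z ∈ Complex.slitPlane) :
    HasDerivAt (fun w => q / w * (laplaceInt q (q - 1) w - laplaceInt q q w))
      (2 * (q / z * (laplaceInt q (q - 1) z - laplaceInt q q z))
        + q * (q + 1) / z ^ 2 * laplaceInt q q z) z := by
  have hz0 : z ≠ 0 := Complex.slitPlane_ne_zero hz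
  have hb1 : (q - 1).re ≤ 0 := by simp; linarith
  have h := laplaceInt_recurrence hq hq0 hz
  have d1 := (hasDerivAt_inv hz0).const_mul q
  have d2 := (hasDerivAt_laplaceInt hq hb1 hz).sub (hasDerivAt_laplaceInt hq hq0 hz)
  have d := d1.mul d2
  refine d.congr_deriv ?_
  rw [show q - 1 - 1 = q - 2 by ring]
  simp only [Pi.sub_apply]
  field_simp
  linear_combination (-q) * h

/-! ### Limits of the integral at infinity and at the origin, and continuity in the order. -/

/-- The last factor of the integrand tends to `1`, leaving Euler's integral. Used for the
asymptotics in the Wronskian and for the initial condition. -/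
lemma tendsto_laplaceInt_of_tendsto_inv {ι : Type*} {l : Filter ι} [l.IsCountablyGenerated]
    {c : ℝ} (hc : 0 < c) {q b : ℂ} (hq : -1 < q.re) (hb : b.re ≤ 0) {ζ : ι → ℂ}
    (hζ : ∀ᶠ i in l, ζ i ∈ Complex.slitPlane) (hζc : ∀ᶠ i in l, RayBound c (ζ i))
    (h : Tendsto (fun i => (ζ i)⁻¹) l (𝓝 0)) :
    Tendsto (fun i => laplaceInt q b (ζ i)) l (𝓝 (Complex.Gamma (q + 1))) := by
  have hG : Complex.Gamma (q + 1) = ∫ u in Ioi (0 : ℝ), (Real.exp (-u) : ℂ) * (u : ℂ) ^ q := by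
    rw [Complex.Gamma_eq_integral (by simp; linarith), Complex.GammaIntegral]
    simp
  rw [hG]
  refine tendsto_integral_filter_of_dominated_convergence
    (fun u => Real.exp (-u) * u ^ q.re * (c ^ b.re * Real.exp (Real.pi * |b.im|))) ?_ ?_
    ((integrableOn_exp_mul_rpow hq).mul_const _) ?_
  · filter_upwards [hζ] with i hi
    exact aestronglyMeasurable_laplaceIntegrand q b hi
  · filter_upwards [hζc] with i hi
    filter_upwards [ae_restrict_mem measurableSet_Ioi] with u hu
    exact norm_laplaceIntegrand_le hc hi hb hu
  · filter_upwards with u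
    have h1 : Tendsto (fun i => 1 + (u : ℂ) / (2 * ζ i)) l (𝓝 1) := by
      have := (h.const_mul ((u : ℂ) / 2)).const_add 1
      simp only [mul_zero, add_zero] at this
      refine this.congr fun i => ?_
      rw [mul_comm 2 (ζ i), div_mul_eq_div_div, div_right_comm, div_eq_mul_inv ((u : ℂ) / 2)]
    have h2 : Tendsto (fun i => (1 + (u : ℂ) / (2 * ζ i)) ^ b) l (𝓝 (1 ^ b)) :=
      (continuousAt_cpow_const (by simp)).tendsto.comp h1
    rw [Complex.one_cpow] at h2
    simpa using h2.const_mul ((Real.exp (-u) : ℂ) * (u : ℂ) ^ q)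

/-- For fixed `u > 0`, `|1 + u/(2ζ)| → ∞`, and the strictly negative `Re b` sends the integrand to
`0`. This is the source of the Dirichlet condition. -/
lemma tendsto_laplaceInt_zero {ι : Type*} {l : Filter ι} [l.IsCountablyGenerated]
    {c : ℝ} (hc : 0 < c) {q b : ℂ} (hq : -1 < q.re) (hb : b.re < 0) {ζ : ι → ℂ}
    (hζ : ∀ᶠ i in l, ζ i ∈ Complex.slitPlane) (hζc : ∀ᶠ i in l, RayBound c (ζ i))
    (h : Tendsto ζ l (𝓝 0)) :
    Tendsto (fun i => laplaceInt q b (ζ i)) l (𝓝 0) := by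
  have h0 : (0 : ℂ) = ∫ u in Ioi (0 : ℝ), (0 : ℂ) := by simp
  rw [h0]
  refine tendsto_integral_filter_of_dominated_convergence
    (fun u => Real.exp (-u) * u ^ q.re * (c ^ b.re * Real.exp (Real.pi * |b.im|))) ?_ ?_
    ((integrableOn_exp_mul_rpow hq).mul_const _) ?_
  · filter_upwards [hζ] with i hi
    exact aestronglyMeasurable_laplaceIntegrand q b hi
  · filter_upwards [hζc] with i hi
    filter_upwards [ae_restrict_mem measurableSet_Ioi] with u hu
    exact norm_laplaceIntegrand_le hc hi hb.le hu
  · filter_upwards [ae_restrict_mem measurableSet_Ioi] with u hu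
    have hu' : 0 < u := hu
    have h1 : Tendsto (fun i => ‖1 + (u : ℂ) / (2 * ζ i)‖) l atTop := by
      have hn : Tendsto (fun i => ‖ζ i‖) l (𝓝[>] 0) := by
        refine tendsto_nhdsWithin_iff.2 ⟨by simpa using h.norm, ?_⟩
        filter_upwards [hζ] with i hi
        exact norm_pos_iff.2 (Complex.slitPlane_ne_zero hi)
      have h2 := tendsto_atTop_add_const_right l (-1 : ℝ)
        ((hn.inv_tendsto_nhdsGT_zero).const_mul_atTop (half_pos hu'))
      refine tendsto_atTop_mono (fun i => ?_) h2
      have e : ‖(u : ℂ) / (2 * ζ i)‖ = u / 2 * ‖ζ i‖⁻¹ := by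
        rw [norm_div, norm_mul, Complex.norm_real, Real.norm_of_nonneg hu'.le, Complex.norm_ofNat,
          div_mul_eq_div_div, div_eq_mul_inv (u / 2)]
      have := norm_sub_le (1 + (u : ℂ) / (2 * ζ i)) 1
      rw [add_sub_cancel_left, e, norm_one] at this
      simp only [Pi.inv_apply]
      linarith
    have h3 : Tendsto (fun i => ‖1 + (u : ℂ) / (2 * ζ i)‖ ^ b.re * Real.exp (Real.pi * |b.im|)) l
        (𝓝 0) := by
      have := (tendsto_rpow_neg_atTop (neg_pos.2 hb)).comp h1
      simpa using this.mul_const (Real.exp (Real.pi * |b.im|))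
    have h4 : Tendsto (fun i => (1 + (u : ℂ) / (2 * ζ i)) ^ b) l (𝓝 0) := by
      refine squeeze_zero_norm' ?_ h3
      filter_upwards [hζ] with i hi
      exact norm_cpow_le_of_le_norm (norm_pos_iff.2 (Complex.slitPlane_ne_zero
        (one_add_div_mem_slitPlane hi hu))) le_rfl hb.le
    simpa using h4.const_mul ((Real.exp (-u) : ℂ) * (u : ℂ) ^ q)

/-- Continuity of `laplaceInt` in the order. -/
lemma continuousAt_laplaceInt_order {q z : ℂ} (hq : -1 < q.re) (hq0 : q.re < 0)
    (hz : z ∈ Complex.slitPlane) : ContinuousAt (fun p => laplaceInt p p z) q := by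
  obtain ⟨c, hc, hev⟩ := eventually_rayBound hz
  have hzc := hev.self_of_nhds
  obtain ⟨r, hr1, hr2⟩ := exists_between hq
  obtain ⟨C, hC⟩ : ∃ C : ℝ, ∀ᶠ p : ℂ in 𝓝 q, c ^ p.re * Real.exp (Real.pi * |p.im|) ≤ C := by
    have hcont : ContinuousAt (fun p : ℂ => c ^ p.re * Real.exp (Real.pi * |p.im|)) q := by
      refine ContinuousAt.mul ?_ (by fun_prop)
      exact continuousAt_const.rpow (by fun_prop) (Or.inl hc.ne')
    exact ⟨_, hcont.eventually_le_const (lt_add_one _)⟩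
  -- For `r < Re p < 0`, `u^{Re p}` is at most `u^r` on `(0,1]` and at most `1` beyond, so the sum
  -- of the two dominates for all `p` near `q`.
  refine tendsto_integral_filter_of_dominated_convergence
    (fun u => (Real.exp (-u) * u ^ r + Real.exp (-u) * u ^ (0 : ℝ)) * C) ?_ ?_ ?_ ?_
  · exact Eventually.of_forall fun p => aestronglyMeasurable_laplaceIntegrand p p hz
  · filter_upwards [hC, (isOpen_lt continuous_const Complex.continuous_re).mem_nhds hr2,
      (isOpen_lt Complex.continuous_re continuous_const).mem_nhds hq0] with p hp1 hp2 hp3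
    filter_upwards [ae_restrict_mem measurableSet_Ioi] with u hu
    have hu' : 0 < u := hu
    have hp2' : r < p.re := hp2
    have hp3' : p.re < 0 := hp3
    refine (norm_laplaceIntegrand_le hc hzc hp3'.le hu).trans ?_
    refine mul_le_mul ?_ hp1 (by positivity) (by positivity)
    rw [← mul_add]
    refine mul_le_mul_of_nonneg_left ?_ (Real.exp_pos _).le
    rcases le_total u 1 with h | h
    · have := Real.rpow_le_rpow_of_exponent_ge hu' h hp2'.le
      exact this.trans (le_add_of_nonneg_right (by positivity))
    · have := Real.rpow_le_rpow_of_exponent_le h hp3'.le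
      exact this.trans (le_add_of_nonneg_left (by positivity))
  · exact ((integrableOn_exp_mul_rpow hr1).add
      (integrableOn_exp_mul_rpow (by norm_num))).mul_const _
  · filter_upwards [ae_restrict_mem measurableSet_Ioi] with u hu
    have hu0 : (u : ℂ) ≠ 0 := Complex.ofReal_ne_zero.2 (ne_of_gt hu)
    have hP0 := Complex.slitPlane_ne_zero (one_add_div_mem_slitPlane hz hu)
    have h1 : ContinuousAt (fun p : ℂ => (Real.exp (-u) : ℂ) * (u : ℂ) ^ p *
        (1 + (u : ℂ) / (2 * z)) ^ p) q :=
      (continuousAt_const.mul (continuousAt_const_cpow hu0)).mul (continuousAt_const_cpow hP0)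
    exact h1

/-! ### The power series behind `J_ν` and `I_ν`. -/

lemma summable_mul_pow_div_factorial {c : ℕ → ℂ} {C : ℝ} (hc : ∀ k, ‖c k‖ ≤ C) (x : ℂ) :
    Summable fun k : ℕ => c k * (x ^ k / k.factorial) := by
  refine Summable.of_norm_bounded ((Real.summable_pow_div_factorial ‖x‖).mul_left C) fun k => ?_
  rw [norm_mul, norm_div, norm_pow, Complex.norm_natCast]
  exact mul_le_mul_of_nonneg_right (hc k) (by positivity)

lemma hasDerivAt_tsum_mul_pow_div_factorial {c : ℕ → ℂ} {C : ℝ} (hc : ∀ k, ‖c k‖ ≤ C) (x : ℂ) :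
    HasDerivAt (fun y : ℂ => ∑' k : ℕ, c k * (y ^ k / k.factorial))
      (∑' k : ℕ, c (k + 1) * (x ^ k / k.factorial)) x := by
  set R : ℝ := ‖x‖ + 1
  have hR : 0 < R := by positivity
  have hC : 0 ≤ C := (norm_nonneg _).trans (hc 0)
  have hfac : ∀ (y : ℂ) (k : ℕ), ((k + 1 : ℕ) : ℂ) * y ^ k / ((k + 1).factorial : ℂ)
      = y ^ k / (k.factorial : ℂ) := by
    intro y k
    have h1 : (k.factorial : ℂ) ≠ 0 := Nat.cast_ne_zero.2 k.factorial_ne_zero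
    have h2 : ((k : ℂ) + 1) ≠ 0 := Nat.cast_add_one_ne_zero k
    rw [Nat.factorial_succ]
    push_cast
    field_simp
  have hbd : ∀ n : ℕ, ∀ y ∈ Metric.ball (0 : ℂ) R,
      ‖c n * ((n : ℂ) * y ^ (n - 1) / n.factorial)‖ ≤
        C * ((n : ℝ) * R ^ (n - 1) / n.factorial) := by
    intro n y hy
    have hy' : ‖y‖ ≤ R := (mem_ball_zero_iff.1 hy).le
    rw [norm_mul, norm_div, norm_mul, norm_pow, Complex.norm_natCast, Complex.norm_natCast]
    gcongr
    exact hc n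
  have hsum : Summable fun n : ℕ => C * ((n : ℝ) * R ^ (n - 1) / n.factorial) := by
    refine Summable.mul_left C ((summable_nat_add_iff 1).1 ?_)
    refine (Real.summable_pow_div_factorial R).congr fun k => ?_
    have h1 : (k.factorial : ℝ) ≠ 0 := Nat.cast_ne_zero.2 k.factorial_ne_zero
    rw [Nat.factorial_succ, Nat.add_sub_cancel]
    push_cast
    field_simp
  have h := hasDerivAt_tsum_of_isPreconnected hsum Metric.isOpen_ball
    (convex_ball (0 : ℂ) R).isPreconnected
    (g := fun n y => c n * (y ^ n / n.factorial))
    (g' := fun n y => c n * ((n : ℂ) * y ^ (n - 1) / n.factorial))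
    (fun n y _ => ((hasDerivAt_pow n y).div_const _).const_mul _) hbd
    (Metric.mem_ball_self hR) (summable_mul_pow_div_factorial hc 0)
    (y := x) (by rw [mem_ball_zero_iff]; exact lt_add_one _)
  refine h.congr_deriv ?_
  rw [Summable.tsum_eq_zero_add (Summable.of_norm_bounded hsum fun n => hbd n x
    (by rw [mem_ball_zero_iff]; exact lt_add_one _))]
  simp only [Nat.cast_zero, zero_mul, zero_div, mul_zero, zero_add, Nat.add_sub_cancel, hfac]

/-- The reciprocal Gamma values `1 / Γ(ν + k + 1)` are bounded in `k`, locally uniformly in `ν`. -/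
lemma exists_bound_inv_Gamma (ν : ℂ) :
    ∃ C : ℝ, ∀ᶠ μ in 𝓝 ν, ∀ k : ℕ, ‖(Complex.Gamma (μ + k + 1))⁻¹‖ ≤ C := by
  obtain ⟨N, hN⟩ := exists_nat_ge (‖ν‖ + 1)
  have hcont : Continuous fun μ : ℂ =>
      ∑ i ∈ Finset.range (N + 1), ‖(Complex.Gamma (μ + i + 1))⁻¹‖ := by
    refine continuous_finsetSum _ fun i _ => ?_
    exact (Complex.differentiable_one_div_Gamma.continuous.comp
      ((continuous_id.add_const _).add_const _)).norm
  refine ⟨∑ i ∈ Finset.range (N + 1), ‖(Complex.Gamma (ν + i + 1))⁻¹‖ + 1, ?_⟩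
  filter_upwards [hcont.continuousAt.eventually_le_const (lt_add_one _),
    Metric.ball_mem_nhds ν one_pos] with μ h1 h2 k
  · have hμ : ‖μ‖ ≤ N := by
      have h3 : ‖μ - ν‖ < 1 := by simpa [dist_eq_norm] using h2
      have := norm_add_le (μ - ν) ν
      rw [sub_add_cancel] at this
      linarith
    refine le_trans ?_ h1
    have hle : ∀ i ≤ N, ‖(Complex.Gamma (μ + i + 1))⁻¹‖ ≤
        ∑ i ∈ Finset.range (N + 1), ‖(Complex.Gamma (μ + i + 1))⁻¹‖ := fun i hi =>
      Finset.single_le_sum (f := fun i : ℕ => ‖(Complex.Gamma (μ + i + 1))⁻¹‖)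
        (fun _ _ => norm_nonneg _) (Finset.mem_range.2 (by omega))
    rcases le_total k N with hk | hk
    · exact hle k hk
    · refine le_trans ?_ (hle N le_rfl)
      induction k, hk using Nat.le_induction with
      | base => exact le_rfl
      | succ k hk ih =>
        refine le_trans ?_ ih
        rw [Complex.one_div_Gamma_eq_self_mul_one_div_Gamma_add_one (μ + k + 1), norm_mul]
        have h4 : 1 ≤ ‖μ + k + 1‖ := by
          have h5 := norm_sub_le (μ + k + 1) μ
          rw [show μ + k + 1 - μ = ((k + 1 : ℕ) : ℂ) by push_cast; ring,
            Complex.norm_natCast] at h5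
          have h6 : (N : ℝ) ≤ k := by exact_mod_cast hk
          push_cast at h5
          linarith
        rw [show μ + ((k + 1 : ℕ) : ℂ) + 1 = μ + k + 1 + 1 by push_cast; ring]
        exact le_mul_of_one_le_left (norm_nonneg _) h4

/-- The entire function `S_ν(x) = ∑ₖ xᵏ / (k! Γ(ν + k + 1))`; one has
`J_ν(w) = (w/2)^ν S_ν(-w²/4)` and `I_ν(w) = (w/2)^ν S_ν(w²/4)`. -/
def besselSeries (ν x : ℂ) : ℂ :=
  ∑' k : ℕ, (Complex.Gamma (ν + k + 1))⁻¹ * (x ^ k / k.factorial)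

lemma exists_bound_inv_Gamma_nat (ν : ℂ) :
    ∃ C : ℝ, ∀ k : ℕ, ‖(Complex.Gamma (ν + k + 1))⁻¹‖ ≤ C :=
  let ⟨C, hC⟩ := exists_bound_inv_Gamma ν
  ⟨C, hC.self_of_nhds⟩

lemma summable_besselSeries (ν x : ℂ) :
    Summable fun k : ℕ => (Complex.Gamma (ν + k + 1))⁻¹ * (x ^ k / k.factorial) :=
  let ⟨_, hC⟩ := exists_bound_inv_Gamma_nat ν
  summable_mul_pow_div_factorial hC x

lemma hasDerivAt_besselSeries (ν x : ℂ) :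
    HasDerivAt (besselSeries ν) (besselSeries (ν + 1) x) x := by
  obtain ⟨C, hC⟩ := exists_bound_inv_Gamma_nat ν
  refine (hasDerivAt_tsum_mul_pow_div_factorial hC x).congr_deriv ?_
  unfold besselSeries
  refine tsum_congr fun k => ?_
  rw [show ν + ((k + 1 : ℕ) : ℂ) + 1 = ν + 1 + k + 1 by push_cast; ring]

lemma besselSeries_zero (ν : ℂ) : besselSeries ν 0 = (Complex.Gamma (ν + 1))⁻¹ := by
  unfold besselSeries
  rw [tsum_eq_single 0]
  · simp
  · intro k hk
    simp [hk]

/-- Since `S_ν' = S_{ν+1}`, this is Bessel's equation `x S'' + (ν+1) S' = S`; termwise it is `1/Γ(s)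
= s/Γ(s+1)`. -/
lemma besselSeries_recurrence (ν x : ℂ) :
    x * besselSeries (ν + 2) x + (ν + 1) * besselSeries (ν + 1) x = besselSeries ν x := by
  have h1 : x * besselSeries (ν + 2) x =
      ∑' k : ℕ, (Complex.Gamma (ν + 1 + k + 1))⁻¹ * (k * (x ^ k / k.factorial)) ∧
      Summable fun k : ℕ => (Complex.Gamma (ν + 1 + k + 1))⁻¹ * (k * (x ^ k / k.factorial)) := by
    have hterm : ∀ k : ℕ, (Complex.Gamma (ν + 1 + ((k + 1 : ℕ) : ℂ) + 1))⁻¹ *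
        (((k + 1 : ℕ) : ℂ) * (x ^ (k + 1) / (k + 1).factorial)) =
        x * ((Complex.Gamma (ν + 2 + k + 1))⁻¹ * (x ^ k / k.factorial)) := by
      intro k
      have h1 : (k.factorial : ℂ) ≠ 0 := Nat.cast_ne_zero.2 k.factorial_ne_zero
      have h2 : ((k : ℂ) + 1) ≠ 0 := Nat.cast_add_one_ne_zero k
      rw [show ν + 1 + ((k + 1 : ℕ) : ℂ) + 1 = ν + 2 + k + 1 by push_cast; ring,
        Nat.factorial_succ, pow_succ]
      push_cast
      field_simp
    have hs : Summable fun k : ℕ =>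
        (Complex.Gamma (ν + 1 + k + 1))⁻¹ * (k * (x ^ k / k.factorial)) := by
      refine (summable_nat_add_iff 1).1 (Summable.congr ?_ fun k => (hterm k).symm)
      exact (summable_besselSeries (ν + 2) x).mul_left x
    refine ⟨?_, hs⟩
    rw [hs.tsum_eq_zero_add, besselSeries, ← tsum_mul_left]
    simp only [hterm]
    simp
  rw [h1.1, besselSeries, besselSeries, ← tsum_mul_left,
    ← h1.2.tsum_add ((summable_besselSeries (ν + 1) x).mul_left (ν + 1))]
  refine tsum_congr fun k => ?_
  rw [Complex.one_div_Gamma_eq_self_mul_one_div_Gamma_add_one (ν + k + 1),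
    show ν + k + 1 + 1 = ν + 1 + k + 1 by ring]
  ring

lemma continuous_besselSeries_order (x : ℂ) : Continuous fun ν => besselSeries ν x := by
  rw [continuous_iff_continuousAt]
  intro ν
  obtain ⟨C, hC⟩ := exists_bound_inv_Gamma ν
  obtain ⟨s, hs, hsub⟩ := hC.exists_mem
  have : ContinuousOn (fun ν => besselSeries ν x) s := by
    refine continuousOn_tsum (fun k => ?_)
      ((Real.summable_pow_div_factorial ‖x‖).mul_left C) fun k μ hμ => ?_
    · refine Continuous.continuousOn (Continuous.mul ?_ continuous_const)
      exact Complex.differentiable_one_div_Gamma.continuous.comp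
        ((continuous_id.add_const _).add_const _)
    · rw [norm_mul, norm_div, norm_pow, Complex.norm_natCast]
      exact mul_le_mul_of_nonneg_right (hsub μ hμ k) (by positivity)
  exact this.continuousAt hs

lemma besselJ_eq (ν w : ℂ) : besselJ ν w = (w / 2) ^ ν * besselSeries ν (-(w / 2) ^ 2) := by
  unfold besselJ besselSeries
  congr 1
  refine tsum_congr fun k => ?_
  rw [neg_pow ((w / 2) ^ 2), ← pow_mul, div_eq_mul_inv, mul_inv]
  ring

/-! ### Poisson's integral and the growth of `I_ν` along the positive axis. -/

/-- Legendre's duplication formula at `k + 1/2`. -/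
lemma Gamma_nat_add_half_div_factorial (k : ℕ) :
    Complex.Gamma (k + 1 / 2) / ((2 * k).factorial : ℂ) =
      (Real.sqrt Real.pi : ℂ) / (4 ^ k * (k.factorial : ℂ)) := by
  have h := Complex.Gamma_mul_Gamma_add_half ((k : ℂ) + 1 / 2)
  rw [show (k : ℂ) + 1 / 2 + 1 / 2 = k + 1 by ring, Complex.Gamma_nat_eq_factorial,
    show 2 * ((k : ℂ) + 1 / 2) = ((2 * k : ℕ) : ℂ) + 1 by push_cast; ring,
    Complex.Gamma_nat_eq_factorial,
    show (1 : ℂ) - (((2 * k : ℕ) : ℂ) + 1) = -((2 * k : ℕ) : ℂ) by ring, Complex.cpow_neg,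
    Complex.cpow_natCast, pow_mul] at h
  have h1 : (k.factorial : ℂ) ≠ 0 := Nat.cast_ne_zero.2 k.factorial_ne_zero
  have h2 : ((2 * k).factorial : ℂ) ≠ 0 := Nat.cast_ne_zero.2 (2 * k).factorial_ne_zero
  norm_num at h
  field_simp at h ⊢
  linear_combination h

/-- `v(2 - v) = 1 - (1 - v)²`, so the substitutions `s = 1 - v` and then `s²` lead to the Beta
integral. -/
lemma integral_pow_mul_cpow (k : ℕ) (q : ℂ) :
    ∫ v in (0 : ℝ)..1, 2 * (1 - (v : ℂ)) ^ (2 * k) * ((v : ℂ) * (2 - v)) ^ q =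
      Complex.betaIntegral (k + 1 / 2) (q + 1) := by
  have e1 := intervalIntegral.integral_comp_sub_left
    (fun s : ℝ => 2 * (s : ℂ) ^ (2 * k) * ((1 - (s : ℂ) ^ 2)) ^ q) (1 : ℝ) (a := 0) (b := 1)
  have e2 : ∫ v in (0 : ℝ)..1, 2 * (1 - (v : ℂ)) ^ (2 * k) * ((v : ℂ) * (2 - v)) ^ q =
      ∫ s in (0 : ℝ)..1, 2 * (s : ℂ) ^ (2 * k) * ((1 - (s : ℂ) ^ 2)) ^ q := by
    simp only [sub_self, sub_zero] at e1
    rw [← e1]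
    refine intervalIntegral.integral_congr fun v _ => ?_
    push_cast
    ring_nf
  symm
  rw [e2, Complex.betaIntegral, intervalIntegral.integral_of_le zero_le_one,
    intervalIntegral.integral_of_le zero_le_one, ← Ioi_inter_Iic]
  -- Extending both integrals by zero to the half-line makes the power substitution applicable.
  rw [← setIntegral_indicator measurableSet_Iic, ← setIntegral_indicator measurableSet_Iic,
    ← integral_comp_rpow_Ioi_of_pos (two_pos : (0 : ℝ) < 2)]
  refine setIntegral_congr_fun measurableSet_Ioi fun s hs => ?_
  have hs' : 0 < s := hs
  have hsq : s ^ (2 : ℝ) = s ^ 2 := Real.rpow_two s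
  have hs1 : s ^ ((2 : ℝ) - 1) = s := by norm_num
  simp only [hsq, hs1, indicator_apply, mem_Iic]
  have hiff : s ≤ 1 ↔ s ^ 2 ≤ 1 := by
    constructor <;> intro h <;> nlinarith
  by_cases h : s ≤ 1
  · rw [if_pos (hiff.1 h), if_pos h]
    have hp : ((s ^ 2 : ℝ) : ℂ) ^ ((k : ℂ) + 1 / 2 - 1) * s = (s : ℂ) ^ (2 * k) := by
      have hs0 : (s : ℂ) ≠ 0 := Complex.ofReal_ne_zero.2 hs'.ne'
      rw [Complex.cpow_def_of_ne_zero (by simpa using hs'.ne'), ← Complex.ofReal_log (by positivity),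
        Real.log_pow]
      have hs3 : (s : ℂ) = Complex.exp (Real.log s : ℝ) := by
        rw [← Complex.ofReal_exp, Real.exp_log hs']
      conv_lhs => rw [hs3]
      rw [← Complex.exp_add]
      conv_rhs => rw [hs3, ← Complex.exp_nat_mul]
      congr 1
      push_cast
      ring
    rw [add_sub_cancel_right, Complex.real_smul, ← hp]
    push_cast
    ring
  · rw [if_neg (fun h' => h (hiff.2 h')), if_neg h]
    simp

lemma intervalIntegrable_cpow_mul_cpow {q : ℂ} (hq : -1 < q.re) :
    IntervalIntegrable (fun v : ℝ => ((v : ℂ) * (2 - v)) ^ q) volume 0 1 := by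
  have h1 : IntervalIntegrable (fun v : ℝ => (v : ℂ) ^ q * (2 - (v : ℂ)) ^ q) volume 0 1 := by
    refine (intervalIntegral.intervalIntegrable_cpow' hq).mul_continuousOn ?_
    intro v hv
    rw [uIcc_of_le zero_le_one] at hv
    apply ContinuousAt.continuousWithinAt
    refine ContinuousAt.cpow (by fun_prop) continuousAt_const ?_
    rw [show (2 : ℂ) - v = ((2 - v : ℝ) : ℂ) by push_cast; ring]
    exact Complex.ofReal_mem_slitPlane.2 (by linarith [hv.2])
  refine h1.congr ?_
  intro v hv
  rw [uIoc_of_le zero_le_one] at hv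
  simp only
  rw [show (2 : ℂ) - v = ((2 - v : ℝ) : ℂ) by push_cast; ring,
    Complex.mul_cpow_ofReal_nonneg hv.1.le (by linarith [hv.2])]

/-- Poisson's integral for the modified Bessel function of the first kind. -/
lemma besselSeries_eq_integral {q : ℂ} (hq : -1 < q.re) (τ : ℝ) :
    (Real.sqrt Real.pi : ℂ) * Complex.Gamma (q + 1) * besselSeries (q + 1 / 2) ((τ / 2) ^ 2) =
      ∫ v in (0 : ℝ)..1, 2 * Complex.cosh (τ * (1 - v)) * ((v : ℂ) * (2 - v)) ^ q := by
  have hw := intervalIntegrable_cpow_mul_cpow hq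
  have hcosh : ∀ x : ℝ, Summable fun k : ℕ => x ^ (2 * k) / ((2 * k).factorial : ℝ) := fun x =>
    (Real.hasSum_cosh x).summable
  have key := intervalIntegral.hasSum_integral_of_dominated_convergence (μ := volume)
    (a := (0 : ℝ)) (b := 1)
    (F := fun (k : ℕ) (v : ℝ) => 2 * ((τ * (1 - v) : ℂ) ^ (2 * k) / ((2 * k).factorial : ℂ)) *
      ((v : ℂ) * (2 - v)) ^ q)
    (f := fun v : ℝ => 2 * Complex.cosh (τ * (1 - v)) * ((v : ℂ) * (2 - v)) ^ q)
    (fun k v => (2 * (|τ| ^ (2 * k) / ((2 * k).factorial : ℝ))) * ‖((v : ℂ) * (2 - v)) ^ q‖)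
    ?_ ?_ ?_ ?_ ?_
  · rw [← key.tsum_eq, besselSeries, ← tsum_mul_left]
    refine tsum_congr fun k => ?_
    have e1 : ∀ v : ℝ, 2 * ((τ * (1 - v) : ℂ) ^ (2 * k) / ((2 * k).factorial : ℂ)) *
        ((v : ℂ) * (2 - v)) ^ q = ((τ : ℂ) ^ (2 * k) / ((2 * k).factorial : ℂ)) *
        (2 * (1 - (v : ℂ)) ^ (2 * k) * ((v : ℂ) * (2 - v)) ^ q) := fun v => by
      rw [mul_pow]; ring
    simp only [e1]
    rw [intervalIntegral.integral_const_mul, integral_pow_mul_cpow]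
    have hB := Complex.Gamma_mul_Gamma_eq_betaIntegral (s := (k : ℂ) + 1 / 2) (t := q + 1)
      (by simp; positivity) (by simp; linarith)
    have hν : (k : ℂ) + 1 / 2 + (q + 1) = q + 1 / 2 + k + 1 := by ring
    rw [hν] at hB
    have hG0 : Complex.Gamma (q + 1 / 2 + k + 1) ≠ 0 := by
      refine Complex.Gamma_ne_zero_of_re_pos ?_
      have : (0 : ℝ) ≤ k := Nat.cast_nonneg k
      simp
      linarith
    have hB' : Complex.betaIntegral (k + 1 / 2) (q + 1) =
        (Complex.Gamma (q + 1 / 2 + k + 1))⁻¹ * (Complex.Gamma (k + 1 / 2) * Complex.Gamma (q + 1)) := by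
      rw [hB, inv_mul_cancel_left₀ hG0]
    have hh := Gamma_nat_add_half_div_factorial k
    have h1 : (k.factorial : ℂ) ≠ 0 := Nat.cast_ne_zero.2 k.factorial_ne_zero
    have h2 : ((2 * k).factorial : ℂ) ≠ 0 := Nat.cast_ne_zero.2 (2 * k).factorial_ne_zero
    rw [hB', show (τ : ℂ) ^ (2 * k) / ((2 * k).factorial : ℂ) *
      ((Complex.Gamma (q + 1 / 2 + k + 1))⁻¹ * (Complex.Gamma (k + 1 / 2) * Complex.Gamma (q + 1))) =
      (τ : ℂ) ^ (2 * k) * (Complex.Gamma (k + 1 / 2) / ((2 * k).factorial : ℂ)) *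
      ((Complex.Gamma (q + 1 / 2 + k + 1))⁻¹ * Complex.Gamma (q + 1)) by ring, hh,
      div_pow, div_pow, ← pow_mul, ← pow_mul, pow_mul (2 : ℂ)]
    norm_num
    field_simp
  · intro k
    refine ((Continuous.aestronglyMeasurable (by fun_prop)).mul ?_)
    rw [uIoc_of_le zero_le_one]
    exact (hw.1).aestronglyMeasurable
  · intro k
    filter_upwards with v hv
    rw [uIoc_of_le zero_le_one] at hv
    rw [norm_mul]
    refine mul_le_mul_of_nonneg_right ?_ (norm_nonneg _)
    rw [norm_mul, norm_div, norm_pow, norm_mul, Complex.norm_natCast, Complex.norm_ofNat,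
      Complex.norm_real, Real.norm_eq_abs]
    have : ‖(1 : ℂ) - v‖ ≤ 1 := by
      rw [show (1 : ℂ) - v = ((1 - v : ℝ) : ℂ) by push_cast; ring, Complex.norm_real,
        Real.norm_eq_abs, abs_le]
      constructor <;> linarith [hv.1, hv.2]
    gcongr
    exact mul_le_of_le_one_right (abs_nonneg _) this
  · filter_upwards with v hv
    exact ((hcosh |τ|).mul_left 2).mul_right _
  · simp_rw [tsum_mul_right]
    exact hw.norm.const_mul _
  · filter_upwards with v hv
    exact ((Complex.hasSum_cosh _).mul_left 2).mul_right _

/-- The mass of Poisson's integral concentrates at `v = 0`. With `v = u/τ` and `2 e^{-τ} cosh(τ - u)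
= e^{-u} + e^{u-2τ}`, dominated convergence leaves `2^q Γ(q + 1)`. -/
lemma tendsto_besselSeries_atTop {q : ℂ} (hq : -1 < q.re) :
    Tendsto (fun τ : ℝ => (τ : ℂ) ^ (q + 1) * (Real.exp (-τ) : ℂ) *
      besselSeries (q + 1 / 2) ((τ / 2) ^ 2)) atTop (𝓝 (2 ^ q / (Real.sqrt Real.pi : ℂ))) := by
  have hπ : (Real.sqrt Real.pi : ℂ) ≠ 0 :=
    Complex.ofReal_ne_zero.2 (Real.sqrt_pos.2 Real.pi_pos).ne'
  have hΓ : Complex.Gamma (q + 1) ≠ 0 := Complex.Gamma_ne_zero_of_re_pos (by simp; linarith)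
  set F : ℝ → ℝ → ℂ := fun τ => (Iic τ).indicator fun u =>
    ((Real.exp (-u) + Real.exp (u - 2 * τ) : ℝ) : ℂ) * (u : ℂ) ^ q * ((2 - u / τ : ℝ) : ℂ) ^ q
    with hF
  have hlim : Tendsto (fun τ => ∫ u in Ioi (0 : ℝ), F τ u) atTop
      (𝓝 (∫ u in Ioi (0 : ℝ), (Real.exp (-u) : ℂ) * (u : ℂ) ^ q * 2 ^ q)) := by
    refine tendsto_integral_filter_of_dominated_convergence
      (fun u => Real.exp (-u) * u ^ q.re * (2 * 2 ^ |q.re|)) ?_ ?_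
      ((integrableOn_exp_mul_rpow hq).mul_const _) ?_
    · filter_upwards [eventually_gt_atTop 0] with τ hτ
      refine AEStronglyMeasurable.indicator ?_ measurableSet_Iic
      exact Measurable.aestronglyMeasurable (by fun_prop)
    · filter_upwards [eventually_gt_atTop 0] with τ hτ
      filter_upwards [ae_restrict_mem measurableSet_Ioi] with u hu
      have hu' : 0 < u := hu
      simp only [hF, indicator_apply, mem_Iic]
      split_ifs with h
      · have hle : u / τ ≤ 1 := (div_le_one hτ).2 h
        have hge : 0 ≤ u / τ := by positivity
        have h2 : 0 < 2 - u / τ := by linarith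
        rw [norm_mul, norm_mul, Complex.norm_cpow_eq_rpow_re_of_pos hu',
          Complex.norm_cpow_eq_rpow_re_of_pos h2, Complex.norm_real,
          Real.norm_of_nonneg (by positivity)]
        -- The cutoff `u ≤ τ` makes the second exponential no larger than the first.
        have e1 : Real.exp (-u) + Real.exp (u - 2 * τ) ≤ 2 * Real.exp (-u) := by
          have : Real.exp (u - 2 * τ) ≤ Real.exp (-u) := Real.exp_le_exp.2 (by linarith)
          linarith
        have e2 : (2 - u / τ) ^ q.re ≤ 2 ^ |q.re| :=
          (Real.rpow_le_rpow_of_exponent_le (by linarith) (le_abs_self _)).trans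
            (Real.rpow_le_rpow h2.le (by linarith) (abs_nonneg _))
        calc (Real.exp (-u) + Real.exp (u - 2 * τ)) * u ^ q.re * (2 - u / τ) ^ q.re
            ≤ 2 * Real.exp (-u) * u ^ q.re * 2 ^ |q.re| := by gcongr
          _ = _ := by ring
      · rw [norm_zero]; positivity
    · filter_upwards [ae_restrict_mem measurableSet_Ioi] with u hu
      have h1 : Tendsto (fun τ : ℝ => ((Real.exp (-u) + Real.exp (u - 2 * τ) : ℝ) : ℂ)) atTop
          (𝓝 (Real.exp (-u) : ℂ)) := by
        refine (Complex.continuous_ofReal.tendsto _).comp ?_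
        have : Tendsto (fun τ : ℝ => u - 2 * τ) atTop atBot :=
          tendsto_atBot_add_const_left _ u
            (tendsto_neg_atTop_atBot.comp (tendsto_id.const_mul_atTop two_pos))
        simpa using (Real.tendsto_exp_atBot.comp this).const_add (Real.exp (-u))
      have h2 : Tendsto (fun τ : ℝ => ((2 - u / τ : ℝ) : ℂ) ^ q) atTop (𝓝 (2 ^ q)) := by
        have h3 : Tendsto (fun τ : ℝ => ((2 - u / τ : ℝ) : ℂ)) atTop (𝓝 ((2 : ℝ) : ℂ)) := by
          refine (Complex.continuous_ofReal.tendsto _).comp ?_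
          simpa using (tendsto_id.const_div_atTop u).const_sub (2 : ℝ)
        have := (continuousAt_cpow_const (a := ((2 : ℝ) : ℂ)) (b := q)
          (Complex.ofReal_mem_slitPlane.2 two_pos)).tendsto.comp h3
        simpa [Function.comp_def] using this
      refine ((h1.mul_const _).mul h2).congr' ?_
      filter_upwards [eventually_ge_atTop u] with τ hτ
      simp only [hF]
      rw [indicator_of_mem (mem_Iic.2 hτ)]
  have hval : ∫ u in Ioi (0 : ℝ), (Real.exp (-u) : ℂ) * (u : ℂ) ^ q * 2 ^ q =
      Complex.Gamma (q + 1) * 2 ^ q := by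
    rw [integral_mul_const, Complex.Gamma_eq_integral (by simp; linarith), Complex.GammaIntegral]
    simp
  rw [hval] at hlim
  have hfin := hlim.const_mul ((Real.sqrt Real.pi : ℂ) * Complex.Gamma (q + 1))⁻¹
  have hconst : ((Real.sqrt Real.pi : ℂ) * Complex.Gamma (q + 1))⁻¹ *
      (Complex.Gamma (q + 1) * 2 ^ q) = 2 ^ q / (Real.sqrt Real.pi : ℂ) := by
    field_simp
  rw [hconst] at hfin
  refine hfin.congr' ?_
  filter_upwards [eventually_gt_atTop 0] with τ hτ
  have hτ0 : (τ : ℂ) ≠ 0 := Complex.ofReal_ne_zero.2 hτ.ne'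
  rw [inv_mul_eq_iff_eq_mul₀ (mul_ne_zero hπ hΓ)]
  have hp := besselSeries_eq_integral hq τ
  have hs := intervalIntegral.integral_comp_div (a := 0) (b := τ)
    (fun v : ℝ => 2 * Complex.cosh (τ * (1 - v)) * ((v : ℂ) * (2 - v)) ^ q) hτ.ne'
  rw [zero_div, div_self hτ.ne', ← hp, Complex.real_smul] at hs
  calc ∫ u in Ioi (0 : ℝ), F τ u
      = ∫ u in (0 : ℝ)..τ, (τ : ℂ) ^ q * (Real.exp (-τ) : ℂ) *
        (2 * Complex.cosh (τ * (1 - (u / τ : ℝ))) *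
          (((u / τ : ℝ) : ℂ) * (2 - (u / τ : ℝ))) ^ q) := by
        rw [intervalIntegral.integral_of_le hτ.le, ← Ioi_inter_Iic]
        simp only [hF]
        rw [setIntegral_indicator measurableSet_Iic]
        refine setIntegral_congr_fun (measurableSet_Ioi.inter measurableSet_Iic) fun u hu => ?_
        have hu0 : 0 < u := hu.1
        have hle : u / τ ≤ 1 := (div_le_one hτ).2 hu.2
        have e1 : (((u / τ : ℝ) : ℂ) * (2 - (u / τ : ℝ))) ^ q =
            ((u / τ : ℝ) : ℂ) ^ q * ((2 - u / τ : ℝ) : ℂ) ^ q := by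
          rw [← Complex.mul_cpow_ofReal_nonneg (by positivity) (by linarith)]
          push_cast; rfl
        have e2 : (u : ℂ) ^ q = (τ : ℂ) ^ q * ((u / τ : ℝ) : ℂ) ^ q := by
          rw [← Complex.mul_cpow_ofReal_nonneg hτ.le (by positivity)]
          congr 1
          push_cast
          field_simp
        have e3 : ((Real.exp (-u) + Real.exp (u - 2 * τ) : ℝ) : ℂ) =
            (Real.exp (-τ) : ℂ) * (2 * Complex.cosh (τ * (1 - (u / τ : ℝ)))) := by
          rw [Complex.two_cosh, mul_add]
          push_cast
          rw [← Complex.exp_add, ← Complex.exp_add, show (τ : ℂ) * (1 - u / τ) = τ - u by field_simp,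
            show -(τ : ℂ) + (τ - u) = -u by ring, show -(τ : ℂ) + -(τ - u) = u - 2 * τ by ring]
        rw [e1, e2, e3]
        ring
    _ = _ := by
        rw [intervalIntegral.integral_const_mul, hs, Complex.cpow_add _ _ hτ0, Complex.cpow_one]
        ring

/-! ### Wronskians and the connection formula. -/

/-- Wronskians of solutions of `u'' = Q u` on the slit plane are constant; the value can be read off
from a limit along the positive real axis. -/
lemma wronskian_eq_of_tendsto {f f₁ g g₁ Q : ℂ → ℂ}
    (hf : ∀ z ∈ Complex.slitPlane, HasDerivAt f (f₁ z) z)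
    (hf₁ : ∀ z ∈ Complex.slitPlane, HasDerivAt f₁ (Q z * f z) z)
    (hg : ∀ z ∈ Complex.slitPlane, HasDerivAt g (g₁ z) z)
    (hg₁ : ∀ z ∈ Complex.slitPlane, HasDerivAt g₁ (Q z * g z) z)
    {l : Filter ℝ} [l.NeBot] (hl : ∀ᶠ τ in l, 0 < τ) {c : ℂ}
    (hc : Tendsto (fun τ : ℝ => f τ * g₁ τ - f₁ τ * g τ) l (𝓝 c))
    {z : ℂ} (hz : z ∈ Complex.slitPlane) : f z * g₁ z - f₁ z * g z = c := by
  have hd : ∀ z ∈ Complex.slitPlane, HasDerivAt (fun w => f w * g₁ w - f₁ w * g w) 0 z := by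
    intro z hz
    refine (((hf z hz).mul (hg₁ z hz)).sub ((hf₁ z hz).mul (hg z hz))).congr_deriv ?_
    ring
  have hconst : ∀ τ : ℝ, 0 < τ → f τ * g₁ τ - f₁ τ * g τ = f z * g₁ z - f₁ z * g z := by
    intro τ hτ
    exact Complex.isOpen_slitPlane.is_const_of_deriv_eq_zero
      (Complex.starConvex_one_slitPlane.isPathConnected
        Complex.one_mem_slitPlane).isConnected.isPreconnected
      (fun w hw => (hd w hw).differentiableAt.differentiableWithinAt)
      (fun w hw => (hd w hw).deriv) (Complex.ofReal_mem_slitPlane.2 hτ) hz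
  refine tendsto_nhds_unique (tendsto_const_nhds.congr' ?_) hc
  filter_upwards [hl] with τ hτ
  exact (hconst τ hτ).symm

/-- The solution `e^{-z} k(z)` of `u'' = (1 + (ν² - 1/4)/z²) u`, `ν = q + 1/2`. -/
def decaying (q z : ℂ) : ℂ := Complex.exp (-z) * laplaceInt q q z

/-- The derivative of `decaying`. -/
def decayingDeriv (q z : ℂ) : ℂ :=
  Complex.exp (-z) * (q / z * (laplaceInt q (q - 1) z - laplaceInt q q z) - laplaceInt q q z)

lemma hasDerivAt_decaying {q z : ℂ} (hq : -1 < q.re) (hq0 : q.re ≤ 0)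
    (hz : z ∈ Complex.slitPlane) : HasDerivAt (decaying q) (decayingDeriv q z) z := by
  refine ((hasDerivAt_neg z).cexp.mul (hasDerivAt_laplaceInt hq hq0 hz)).congr_deriv ?_
  rw [decayingDeriv]
  ring

lemma hasDerivAt_decayingDeriv {q z : ℂ} (hq : -1 < q.re) (hq0 : q.re ≤ 0)
    (hz : z ∈ Complex.slitPlane) :
    HasDerivAt (decayingDeriv q) ((1 + q * (q + 1) / z ^ 2) * decaying q z) z := by
  refine ((hasDerivAt_neg z).cexp.mul ((hasDerivAt_deriv_laplaceInt hq hq0 hz).sub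
    (hasDerivAt_laplaceInt hq hq0 hz))).congr_deriv ?_
  rw [decaying]
  simp only [Pi.sub_apply]
  ring

/-- The solution `z^{ν+1/2} S_ν(z²/4)`, a multiple of `√z I_ν(z)`. -/
def growing (ν z : ℂ) : ℂ := z ^ (ν + 1 / 2) * besselSeries ν ((z / 2) ^ 2)

/-- The derivative of `growing`. -/
def growingDeriv (ν z : ℂ) : ℂ :=
  z ^ (ν - 1 / 2) * ((ν + 1 / 2) * besselSeries ν ((z / 2) ^ 2) +
    z ^ 2 / 2 * besselSeries (ν + 1) ((z / 2) ^ 2))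

lemma hasDerivAt_besselSeries_sq (ν z : ℂ) :
    HasDerivAt (fun w : ℂ => besselSeries ν ((w / 2) ^ 2))
      (z / 2 * besselSeries (ν + 1) ((z / 2) ^ 2)) z := by
  have h1 : HasDerivAt (fun w : ℂ => (w / 2) ^ 2) (z / 2) z := by
    refine (((hasDerivAt_id z).div_const 2).pow 2).congr_deriv ?_
    simp
    ring
  refine ((hasDerivAt_besselSeries ν ((z / 2) ^ 2)).comp z h1).congr_deriv ?_
  ring

lemma hasDerivAt_growing (ν : ℂ) {z : ℂ} (hz : z ∈ Complex.slitPlane) :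
    HasDerivAt (growing ν) (growingDeriv ν z) z := by
  have hz0 : z ≠ 0 := Complex.slitPlane_ne_zero hz
  have h1 : HasDerivAt (fun w : ℂ => w ^ (ν + 1 / 2)) ((ν + 1 / 2) * z ^ (ν + 1 / 2 - 1) * 1) z :=
    (hasDerivAt_id z).cpow_const hz
  refine (h1.mul (hasDerivAt_besselSeries_sq ν z)).congr_deriv ?_
  rw [growingDeriv, cpow_eq_cpow_sub_one_mul hz0 (ν + 1 / 2),
    show ν + 1 / 2 - 1 = ν - 1 / 2 by ring]
  ring

lemma hasDerivAt_growingDeriv (ν : ℂ) {z : ℂ} (hz : z ∈ Complex.slitPlane) :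
    HasDerivAt (growingDeriv ν) ((1 + (ν ^ 2 - 1 / 4) / z ^ 2) * growing ν z) z := by
  have hz0 : z ≠ 0 := Complex.slitPlane_ne_zero hz
  have h1 : HasDerivAt (fun w : ℂ => w ^ (ν - 1 / 2)) ((ν - 1 / 2) * z ^ (ν - 1 / 2 - 1) * 1) z :=
    (hasDerivAt_id z).cpow_const hz
  have h2 : HasDerivAt (fun w : ℂ => w ^ 2 / 2) z z := by
    refine ((hasDerivAt_pow 2 z).div_const 2).congr_deriv ?_
    simp
  have h3 := ((hasDerivAt_besselSeries_sq ν z).const_mul (ν + 1 / 2)).add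
    (h2.mul (hasDerivAt_besselSeries_sq (ν + 1) z))
  refine (h1.mul h3).congr_deriv ?_
  have hrec := besselSeries_recurrence ν ((z / 2) ^ 2)
  rw [growing, cpow_eq_cpow_sub_one_mul hz0 (ν + 1 / 2),
    show ν + 1 / 2 - 1 = ν - 1 / 2 by ring, cpow_eq_cpow_sub_one_mul hz0 (ν - 1 / 2),
    ← hrec, show ν + 1 + 1 = ν + 2 by ring]
  simp only [Pi.add_apply, Pi.mul_apply]
  rw [← hrec]
  field_simp
  ring

lemma tendsto_growing_atTop {ν : ℂ} (hν : -(1 / 2) < ν.re) :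
    Tendsto (fun τ : ℝ => (Real.exp (-τ) : ℂ) * growing ν τ) atTop
      (𝓝 (2 ^ (ν - 1 / 2) / (Real.sqrt Real.pi : ℂ))) := by
  have h := tendsto_besselSeries_atTop (q := ν - 1 / 2) (by simp; linarith)
  refine h.congr fun τ => ?_
  rw [growing, show ν - 1 / 2 + 1 = ν + 1 / 2 by ring, show ν - 1 / 2 + 1 / 2 = ν by ring]
  ring

lemma tendsto_ofReal_inv_atTop : Tendsto (fun τ : ℝ => (τ : ℂ)⁻¹) atTop (𝓝 0) := by
  simpa [Function.comp_def] using
    (Complex.continuous_ofReal.tendsto _).comp (tendsto_inv_atTop_zero (𝕜 := ℝ))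

/-- The derivative equals `(ν + 1/2)/τ · growing ν + (1/2) · growing (ν + 1)`; the first term dies
and the factor `1/2` absorbs the extra power of `2` in the second. -/
lemma tendsto_growingDeriv_atTop {ν : ℂ} (hν : -(1 / 2) < ν.re) :
    Tendsto (fun τ : ℝ => (Real.exp (-τ) : ℂ) * growingDeriv ν τ) atTop
      (𝓝 (2 ^ (ν - 1 / 2) / (Real.sqrt Real.pi : ℂ))) := by
  have h0 := (tendsto_ofReal_inv_atTop.mul (tendsto_growing_atTop hν)).const_mul (ν + 1 / 2)
  have h1 := (tendsto_growing_atTop (ν := ν + 1) (by simp; linarith)).const_mul (1 / 2)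
  have h := h0.add h1
  have e : (ν + 1 / 2) * (0 * (2 ^ (ν - 1 / 2) / (Real.sqrt Real.pi : ℂ))) +
      1 / 2 * (2 ^ (ν + 1 - 1 / 2) / (Real.sqrt Real.pi : ℂ)) =
      2 ^ (ν - 1 / 2) / (Real.sqrt Real.pi : ℂ) := by
    rw [cpow_eq_cpow_sub_one_mul two_ne_zero (ν + 1 - 1 / 2),
      show ν + 1 - 1 / 2 - 1 = ν - 1 / 2 by ring]
    ring
  rw [e] at h
  refine h.congr' ?_
  filter_upwards [eventually_gt_atTop 0] with τ hτ
  have hτ0 : (τ : ℂ) ≠ 0 := Complex.ofReal_ne_zero.2 hτ.ne'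
  rw [growing, growing, growingDeriv, cpow_eq_cpow_sub_one_mul hτ0 (ν + 1 + 1 / 2),
    show ν + 1 + 1 / 2 - 1 = ν + 1 / 2 by ring, cpow_eq_cpow_sub_one_mul hτ0 (ν + 1 / 2),
    show ν + 1 / 2 - 1 = ν - 1 / 2 by ring]
  field_simp

/-- The equation depends on the order only through `ν²`, so `μ = ±ν` are both admissible. At `+∞`
the exponentials cancel, and since the decaying solution and its derivative have opposite leading
coefficients, the two products add up, giving the factor `2`. -/
lemma wronskian_decaying_growing {ν μ z : ℂ} (hν : -(1 / 2) < ν.re) (hν' : ν.re < 1 / 2)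
    (hμ : -(1 / 2) < μ.re) (hsq : μ ^ 2 = ν ^ 2) (hz : z ∈ Complex.slitPlane) :
    decaying (ν - 1 / 2) z * growingDeriv μ z - decayingDeriv (ν - 1 / 2) z * growing μ z =
      2 * Complex.Gamma (ν + 1 / 2) * (2 ^ (μ - 1 / 2) / (Real.sqrt Real.pi : ℂ)) := by
  have hq : -1 < (ν - 1 / 2).re := by simp; linarith
  have hq0 : (ν - 1 / 2).re ≤ 0 := by simp; linarith
  have hq1 : (ν - 1 / 2 - 1).re ≤ 0 := by simp; linarith
  have hslit : ∀ᶠ τ : ℝ in atTop, (τ : ℂ) ∈ Complex.slitPlane := by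
    filter_upwards [eventually_gt_atTop 0] with τ hτ
    exact Complex.ofReal_mem_slitPlane.2 hτ
  have hray : ∀ᶠ τ : ℝ in atTop, RayBound 1 (τ : ℂ) := by
    filter_upwards [eventually_gt_atTop 0] with τ hτ
    exact rayBound_one (by simpa using hτ.le) (Complex.ofReal_ne_zero.2 hτ.ne')
  have k0 := tendsto_laplaceInt_of_tendsto_inv one_pos hq hq0 hslit hray tendsto_ofReal_inv_atTop
  have k1 := tendsto_laplaceInt_of_tendsto_inv one_pos hq hq1 hslit hray tendsto_ofReal_inv_atTop
  have kd := ((tendsto_ofReal_inv_atTop.mul (k1.sub k0)).const_mul (ν - 1 / 2)).sub k0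
  have hlim := (k0.mul (tendsto_growingDeriv_atTop hμ)).sub (kd.mul (tendsto_growing_atTop hμ))
  refine wronskian_eq_of_tendsto (Q := fun z => 1 + (ν ^ 2 - 1 / 4) / z ^ 2)
    (fun w hw => hasDerivAt_decaying hq hq0 hw) (fun w hw => ?_)
    (fun w hw => hasDerivAt_growing μ hw) (fun w hw => ?_) (eventually_gt_atTop 0) ?_ hz
  · refine (hasDerivAt_decayingDeriv hq hq0 hw).congr_deriv ?_
    ring
  · refine (hasDerivAt_growingDeriv μ hw).congr_deriv ?_
    rw [hsq]
  · refine (hlim.congr fun τ => ?_).congr' EventuallyEq.rfl |>.trans_eq ?_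
    · rw [decaying, decayingDeriv]
      push_cast
      ring
    · rw [show ν - 1 / 2 + 1 = ν + 1 / 2 by ring]
      congr 1
      ring

/-- At the origin the powers cancel and `2ν/(Γ(1+ν) Γ(1-ν))` remains; the reflection formula
evaluates it. -/
lemma wronskian_growing_growing {ν z : ℂ} (hν : ν ≠ 0) (hz : z ∈ Complex.slitPlane) :
    growing (-ν) z * growingDeriv ν z - growingDeriv (-ν) z * growing ν z =
      2 * Complex.sin (Real.pi * ν) / Real.pi := by
  refine wronskian_eq_of_tendsto (Q := fun z => 1 + (ν ^ 2 - 1 / 4) / z ^ 2) (l := 𝓝[>] 0)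
    (fun w hw => hasDerivAt_growing (-ν) hw) (fun w hw => ?_)
    (fun w hw => hasDerivAt_growing ν hw) (fun w hw => hasDerivAt_growingDeriv ν hw)
    self_mem_nhdsWithin ?_ hz
  · refine (hasDerivAt_growingDeriv (-ν) hw).congr_deriv ?_
    rw [neg_sq]
  · set B : ℂ → ℂ → ℂ := fun μ w => besselSeries μ ((w / 2) ^ 2) with hB
    have hcont : ∀ μ, Continuous (B μ) := fun μ =>
      continuous_iff_continuousAt.2 fun w => (hasDerivAt_besselSeries_sq μ w).continuousAt
    have h1 : Continuous fun τ : ℝ => B (-ν) τ * ((ν + 1 / 2) * B ν τ + τ ^ 2 / 2 * B (ν + 1) τ) -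
        ((-ν + 1 / 2) * B (-ν) τ + τ ^ 2 / 2 * B (-ν + 1) τ) * B ν τ := by
      have := fun μ => (hcont μ).comp Complex.continuous_ofReal
      simp only [Function.comp_def] at this
      have a1 := this ν
      have a2 := this (-ν)
      have a3 := this (ν + 1)
      have a4 := this (-ν + 1)
      fun_prop
    have h2 := (h1.tendsto 0).mono_left (nhdsWithin_le_nhds (s := Ioi 0))
    refine Tendsto.congr' ?_ (h2.trans_eq ?_)
    · filter_upwards [self_mem_nhdsWithin] with τ hτ
      have hτ0 : (τ : ℂ) ≠ 0 := Complex.ofReal_ne_zero.2 (ne_of_gt hτ)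
      have e1 : (τ : ℂ) ^ (-ν + 1 / 2) * (τ : ℂ) ^ (ν - 1 / 2) = 1 := by
        rw [← Complex.cpow_add _ _ hτ0]; simp
      have e2 : (τ : ℂ) ^ (-ν - 1 / 2) * (τ : ℂ) ^ (ν + 1 / 2) = 1 := by
        rw [← Complex.cpow_add _ _ hτ0]; simp
      simp only [growing, growingDeriv, hB]
      linear_combination (-(besselSeries (-ν) ((τ / 2) ^ 2) * ((ν + 1 / 2) *
        besselSeries ν ((τ / 2) ^ 2) + τ ^ 2 / 2 * besselSeries (ν + 1) ((τ / 2) ^ 2)))) * e1 +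
        (((-ν + 1 / 2) * besselSeries (-ν) ((τ / 2) ^ 2) + τ ^ 2 / 2 *
          besselSeries (-ν + 1) ((τ / 2) ^ 2)) * besselSeries ν ((τ / 2) ^ 2)) * e2
    · congr 1
      have h3 : B ν 0 = (ν * Complex.Gamma ν)⁻¹ := by
        simp [hB, besselSeries_zero, Complex.Gamma_add_one ν hν]
      have h4 : B (-ν) 0 = (Complex.Gamma (1 - ν))⁻¹ := by
        simp [hB, besselSeries_zero, neg_add_eq_sub]
      have h5 := Complex.Gamma_mul_Gamma_one_sub ν
      have h6 : (Complex.Gamma ν)⁻¹ * (Complex.Gamma (1 - ν))⁻¹ =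
          Complex.sin (Real.pi * ν) / Real.pi := by
        rw [← mul_inv, h5, inv_div]
      simp only [Complex.ofReal_zero]
      rw [h3, h4, mul_inv]
      have h7 : ν * ν⁻¹ = 1 := mul_inv_cancel₀ hν
      linear_combination 2 * (Complex.Gamma ν)⁻¹ * (Complex.Gamma (1 - ν))⁻¹ * h7 + 2 * h6

/-- For three solutions of one second-order equation, `D · W(g₋, g₊) = g₋ W(D, g₊) - g₊ W(D, g₋)`,
an algebraic identity into which the constant Wronskians are inserted. -/
lemma decaying_connection {ν z : ℂ} (hν0 : ν ≠ 0) (hν : -(1 / 2) < ν.re) (hν' : ν.re < 1 / 2)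
    (hz : z ∈ Complex.slitPlane) :
    decaying (ν - 1 / 2) z * (2 * Complex.sin (Real.pi * ν) / Real.pi) =
      2 * Complex.Gamma (ν + 1 / 2) / (Real.sqrt Real.pi : ℂ) *
        (2 ^ (ν - 1 / 2) * growing (-ν) z - 2 ^ (-ν - 1 / 2) * growing ν z) := by
  rw [← wronskian_growing_growing hν0 hz]
  have h1 := wronskian_decaying_growing hν hν' hν rfl hz
  have h2 := wronskian_decaying_growing (μ := -ν) hν hν' (by simp; linarith) (neg_sq ν) hz
  linear_combination growing (-ν) z * h1 - growing ν z * h2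

/-! ### Identification with the Hankel function. -/

lemma I_mul_ofReal_cpow {w : ℝ} (hw : 0 < w) (a : ℂ) :
    (Complex.I * (w : ℂ)) ^ a = Complex.I ^ a * (w : ℂ) ^ a := by
  have hw0 : (w : ℂ) ≠ 0 := Complex.ofReal_ne_zero.2 hw.ne'
  rw [mul_comm, Complex.cpow_def_of_ne_zero (mul_ne_zero hw0 Complex.I_ne_zero),
    Complex.cpow_def_of_ne_zero hw0, Complex.cpow_def_of_ne_zero Complex.I_ne_zero,
    Complex.log_ofReal_mul hw Complex.I_ne_zero, ← Complex.exp_add, Complex.ofReal_log hw.le]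
  ring_nf

lemma ofReal_sqrt_eq_cpow {w : ℝ} (hw : 0 ≤ w) : (Real.sqrt w : ℂ) = (w : ℂ) ^ (1 / 2 : ℂ) := by
  rw [Real.sqrt_eq_rpow, Complex.ofReal_cpow hw]
  norm_num

/-- On the positive imaginary axis `(iw/2)² = -(w/2)²`, which turns the series of `I_ν` into that of
`J_ν`. -/
lemma growing_I_mul (ν : ℂ) {w : ℝ} (hw : 0 < w) :
    2 ^ (-ν - 1 / 2) * growing ν (Complex.I * w) * (Real.sqrt 2 : ℂ) =
      Complex.I ^ (ν + 1 / 2) * (Real.sqrt w : ℂ) * besselJ ν w := by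
  have hw0 : (w : ℂ) ≠ 0 := Complex.ofReal_ne_zero.2 hw.ne'
  have h2 : (w : ℂ) ^ ν = 2 ^ ν * (w / 2) ^ ν := by
    have := Complex.mul_cpow_ofReal_nonneg (zero_le_two) (by positivity : 0 ≤ w / 2) ν
    push_cast at this
    rw [← this]
    congr 1
    ring
  have h3 : (2 : ℂ) ^ (-ν - 1 / 2) * 2 ^ (1 / 2 : ℂ) * 2 ^ ν = 1 := by
    rw [← Complex.cpow_add _ _ two_ne_zero, ← Complex.cpow_add _ _ two_ne_zero]
    rw [show -ν - 1 / 2 + 1 / 2 + ν = 0 by ring, Complex.cpow_zero]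
  rw [growing, besselJ_eq, I_mul_ofReal_cpow hw, Complex.cpow_add ν (1 / 2) hw0, h2,
    ofReal_sqrt_eq_cpow hw.le, ofReal_sqrt_eq_cpow zero_le_two,
    show (Complex.I * (w : ℂ) / 2) ^ 2 = -((w : ℂ) / 2) ^ 2 by
      rw [mul_div_assoc, mul_pow, Complex.I_sq]; ring]
  push_cast
  linear_combination (Complex.I ^ (ν + 1 / 2) * (w : ℂ) ^ (1 / 2 : ℂ) * ((w : ℂ) / 2) ^ ν *
    besselSeries ν (-((w : ℂ) / 2) ^ 2)) * h3

lemma not_exists_int_of_re {ν : ℂ} (hν0 : ν ≠ 0) (hν : -(1 / 2) < ν.re) (hν' : ν.re < 1 / 2) :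
    ¬ ∃ n : ℤ, ν = n := by
  rintro ⟨n, rfl⟩
  rw [Complex.intCast_re] at hν hν'
  have h1 : (-1 : ℝ) < n := by linarith
  have h2 : (n : ℝ) < 1 := by linarith
  have h3 : -1 < n := by exact_mod_cast h1
  have h4 : n < 1 := by exact_mod_cast h2
  have : n = 0 := by omega
  simp [this] at hν0

lemma sin_pi_mul_ne_zero {ν : ℂ} (hν0 : ν ≠ 0) (hν : -(1 / 2) < ν.re) (hν' : ν.re < 1 / 2) :
    Complex.sin (Real.pi * ν) ≠ 0 := by
  intro h
  obtain ⟨k, hk⟩ := Complex.sin_eq_zero_iff.1 h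
  refine not_exists_int_of_re hν0 hν hν' ⟨k, ?_⟩
  have hπ : (Real.pi : ℂ) ≠ 0 := Complex.ofReal_ne_zero.2 Real.pi_ne_zero
  rw [mul_comm] at hk
  exact mul_right_cancel₀ hπ hk

/-- The constant in the Laplace-type integral of the Hankel function. -/
def hankelConst (ν : ℂ) : ℂ :=
  Complex.I ^ (ν + 1 / 2) * ((Real.sqrt 2 : ℂ) / (Real.sqrt Real.pi : ℂ)) *
    (Complex.Gamma (ν + 1 / 2))⁻¹

lemma sqrt_mul_hankel_of_ne_zero {ν : ℂ} (hν0 : ν ≠ 0) (hν : -(1 / 2) < ν.re)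
    (hν' : ν.re < 1 / 2) {w : ℝ} (hw : 0 < w) :
    (Real.sqrt w : ℂ) * (besselJ ν w - Complex.I * besselYQuot ν w) =
      hankelConst ν * decaying (ν - 1 / 2) (Complex.I * w) := by
  have hs := sin_pi_mul_ne_zero hν0 hν hν'
  have hslit : Complex.I * (w : ℂ) ∈ Complex.slitPlane := by
    rw [Complex.mem_slitPlane_iff]
    right
    simpa using hw.ne'
  have hc := decaying_connection hν0 hν hν' hslit
  have g1 := growing_I_mul ν hw
  have g2 := growing_I_mul (-ν) hw
  rw [neg_neg] at g2
  have hπ : (Real.sqrt Real.pi : ℂ) ≠ 0 :=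
    Complex.ofReal_ne_zero.2 (Real.sqrt_pos.2 Real.pi_pos).ne'
  have hπ2 : (Real.pi : ℂ) = (Real.sqrt Real.pi : ℂ) ^ 2 := by
    rw [← Complex.ofReal_pow, Real.sq_sqrt Real.pi_pos.le]
  have hΓ : Complex.Gamma (ν + 1 / 2) ≠ 0 :=
    Complex.Gamma_ne_zero_of_re_pos (by simp; linarith)
  have hpm : Complex.I ^ (ν + 1 / 2) * Complex.I ^ (-ν + 1 / 2) = Complex.I := by
    rw [← Complex.cpow_add _ _ Complex.I_ne_zero, show ν + 1 / 2 + (-ν + 1 / 2) = 1 by ring,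
      Complex.cpow_one]
  -- `i^{2ν+1} = i e^{iπν}` supplies the cosine and sine in the definition of `Y_ν`.
  have hpp : Complex.I ^ (ν + 1 / 2) * Complex.I ^ (ν + 1 / 2) =
      Complex.I * (Complex.cos (Real.pi * ν) + Complex.sin (Real.pi * ν) * Complex.I) := by
    rw [← Complex.cpow_add _ _ Complex.I_ne_zero, ← Complex.exp_mul_I,
      show ν + 1 / 2 + (ν + 1 / 2) = 1 + 2 * ν by ring, Complex.cpow_add _ _ Complex.I_ne_zero,
      Complex.cpow_one, Complex.cpow_def_of_ne_zero Complex.I_ne_zero, Complex.log_I]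
    ring_nf
  set s := Complex.sin (Real.pi * ν)
  set c := Complex.cos (Real.pi * ν)
  set D := decaying (ν - 1 / 2) (Complex.I * w)
  set G := Complex.Gamma (ν + 1 / 2)
  have hD : D * s * (Real.sqrt 2 : ℂ) = G * (Real.sqrt Real.pi : ℂ) * (Real.sqrt w : ℂ) *
      (Complex.I ^ (-ν + 1 / 2) * besselJ (-ν) w - Complex.I ^ (ν + 1 / 2) * besselJ ν w) := by
    rw [hπ2] at hc
    generalize (2 : ℂ) ^ (ν - 1 / 2) = a at hc g2
    generalize (2 : ℂ) ^ (-ν - 1 / 2) = b at hc g1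
    field_simp at hc
    linear_combination (Real.sqrt 2 : ℂ) * hc + (G * (Real.sqrt Real.pi : ℂ)) * (g2 - g1)
  have hR : hankelConst ν * D * s = (Real.sqrt w : ℂ) * (Complex.I ^ (ν + 1 / 2) *
      (Complex.I ^ (-ν + 1 / 2) * besselJ (-ν) w - Complex.I ^ (ν + 1 / 2) * besselJ ν w)) := by
    have e : hankelConst ν * D * s =
        Complex.I ^ (ν + 1 / 2) * (D * s * (Real.sqrt 2 : ℂ)) / ((Real.sqrt Real.pi : ℂ) * G) := by
      change Complex.I ^ (ν + 1 / 2) * ((Real.sqrt 2 : ℂ) / (Real.sqrt Real.pi : ℂ)) * G⁻¹ * D * s = _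
      ring
    rw [e, hD]
    field_simp
  refine mul_right_cancel₀ hs ?_
  rw [hR, besselYQuot]
  change (Real.sqrt w : ℂ) * (besselJ ν w - Complex.I * ((besselJ ν w * c - besselJ (-ν) w) / s)) * s
    = _
  have e2 : (besselJ ν w * c - besselJ (-ν) w) / s * s = besselJ ν w * c - besselJ (-ν) w :=
    div_mul_cancel₀ _ hs
  linear_combination (-(Real.sqrt w : ℂ) * Complex.I) * e2 -
    (Real.sqrt w : ℂ) * besselJ (-ν) w * hpm + (Real.sqrt w : ℂ) * besselJ ν w * hpp +
    (Real.sqrt w : ℂ) * besselJ ν w * s * Complex.I_mul_I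

lemma continuousAt_hankelConst (ν : ℂ) : ContinuousAt hankelConst ν := by
  unfold hankelConst
  refine (ContinuousAt.mul ?_ continuousAt_const).mul ?_
  · exact (continuousAt_const_cpow Complex.I_ne_zero).comp (by fun_prop)
  · exact (Complex.differentiable_one_div_Gamma.continuous.comp
      (continuous_id.add_const _)).continuousAt

lemma continuousAt_besselJ_order (ν : ℂ) {w : ℂ} (hw : w ≠ 0) :
    ContinuousAt (fun μ => besselJ μ w) ν := by
  simp only [besselJ_eq]
  exact (continuousAt_const_cpow (div_ne_zero hw two_ne_zero)).mul
    (continuous_besselSeries_order _).continuousAt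

/-- Hankel's integral: `√w H_ν^{(2)}(w)` is a multiple of `e^{-iw} k(iw)`. -/
lemma sqrt_mul_hankelH2 {ν : ℂ} (hν : -(1 / 2) < ν.re) (hν' : ν.re < 1 / 2) {w : ℝ}
    (hw : 0 < w) :
    (Real.sqrt w : ℂ) * hankelH2 ν w =
      hankelConst ν * decaying (ν - 1 / 2) (Complex.I * w) := by
  by_cases hν0 : ν = 0
  · subst hν0
    have hw0 : (w : ℂ) ≠ 0 := Complex.ofReal_ne_zero.2 hw.ne'
    have hsw : (Real.sqrt w : ℂ) ≠ 0 := Complex.ofReal_ne_zero.2 (Real.sqrt_pos.2 hw).ne'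
    have hslit : Complex.I * (w : ℂ) ∈ Complex.slitPlane := by
      rw [Complex.mem_slitPlane_iff]
      right
      simpa using hw.ne'
    set R : ℂ → ℂ := fun μ => hankelConst μ * decaying (μ - 1 / 2) (Complex.I * w) with hR
    have hRc : ContinuousAt R 0 := by
      refine (continuousAt_hankelConst 0).mul (continuousAt_const.mul ?_)
      have h := continuousAt_laplaceInt_order (q := 0 - 1 / 2) (by norm_num) (by norm_num) hslit
      exact h.comp (f := fun μ : ℂ => μ - 1 / 2) (by fun_prop)
    -- At order `0`, `Y` is defined as a limit of quotients. The formula for nonzero order, solved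
    -- for the quotient, has a right side continuous at `0`, so the limit exists and is its value
    -- there.
    have hlim : Tendsto (fun μ : ℂ => besselYQuot μ w) (𝓝[≠] 0)
        (𝓝 (Complex.I * (R 0 / (Real.sqrt w : ℂ) - besselJ 0 w))) := by
      have h1 : ContinuousAt (fun μ : ℂ =>
          Complex.I * (R μ / (Real.sqrt w : ℂ) - besselJ μ w)) 0 :=
        ((hRc.div_const _).sub (continuousAt_besselJ_order 0 hw0)).const_mul _
      refine (h1.tendsto.mono_left nhdsWithin_le_nhds).congr' ?_
      have hre1 : ∀ᶠ μ : ℂ in 𝓝[≠] 0, -(1 / 2) < μ.re := nhdsWithin_le_nhds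
        ((isOpen_lt continuous_const Complex.continuous_re).mem_nhds (by simp))
      have hre2 : ∀ᶠ μ : ℂ in 𝓝[≠] 0, μ.re < 1 / 2 := nhdsWithin_le_nhds
        ((isOpen_lt Complex.continuous_re continuous_const).mem_nhds (by simp))
      filter_upwards [hre1, hre2, self_mem_nhdsWithin] with μ h2 h3 h4
      have h5 := sqrt_mul_hankel_of_ne_zero h4 h2 h3 hw
      have h6 : R μ / (Real.sqrt w : ℂ) = besselJ μ w - Complex.I * besselYQuot μ w := by
        rw [div_eq_iff hsw, hR]
        simp only
        rw [← h5]; ring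
      rw [h6]
      linear_combination (-besselYQuot μ w) * Complex.I_mul_I
    have hY : besselY 0 w = Complex.I * (R 0 / (Real.sqrt w : ℂ) - besselJ 0 w) := by
      rw [besselY, if_pos ⟨0, by simp⟩]
      exact hlim.limUnder_eq
    rw [hankelH2, hY]
    have : (Real.sqrt w : ℂ) * (R 0 / (Real.sqrt w : ℂ)) = R 0 := mul_div_cancel₀ _ hsw
    linear_combination this + (Real.sqrt w : ℂ) * (besselJ 0 w - R 0 / (Real.sqrt w : ℂ)) *
      Complex.I_mul_I
  · rw [hankelH2, besselY, if_neg (not_exists_int_of_re hν0 hν hν')]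
    exact sqrt_mul_hankel_of_ne_zero hν0 hν hν' hw

/-! ### Absolute continuity from holomorphic extensions. -/

lemma AC_of_hasDerivAt {E : Type*} [NormedAddCommGroup E] [NormedSpace ℝ E] [CompleteSpace E]
    {f f' : ℝ → E} {I : Set ℝ} (hI : I.OrdConnected) (hIm : MeasurableSet I)
    (hf : ∀ t ∈ I, HasDerivAt f (f' t) t) (hf' : ContinuousOn f' I) : AC f I := by
  refine ⟨f', hf'.locallyIntegrableOn hIm, fun x hx y hy => ?_⟩
  have hsub : uIcc x y ⊆ I := hI.uIcc_subset hx hy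
  exact (intervalIntegral.integral_eq_sub_of_hasDerivAt (fun t ht => hf t (hsub ht))
    (hf'.mono hsub).intervalIntegrable).symm

/-- A function on a real interval that extends holomorphically has the derivative of the extension
and is absolutely continuous. -/
lemma deriv_and_AC_of_differentiableOn {F : ℂ → ℂ} {U : Set ℂ} (hU : IsOpen U)
    (hF : DifferentiableOn ℂ F U) {f : ℝ → ℂ} {I : Set ℝ} (hI : I.OrdConnected) (hIo : IsOpen I)
    (hIU : ∀ t ∈ I, (t : ℂ) ∈ U) (hf : ∀ t ∈ I, f t = F t) :
    (∀ t ∈ I, deriv f t = deriv F t) ∧ AC f I := by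
  have hd : ∀ t ∈ I, HasDerivAt f (deriv F t) t := by
    intro t ht
    have h1 := ((hF.differentiableAt (hU.mem_nhds (hIU t ht))).hasDerivAt).comp_ofReal
    refine h1.congr_of_eventuallyEq ?_
    filter_upwards [hIo.mem_nhds ht] with s hs using hf s hs
  refine ⟨fun t ht => (hd t ht).deriv, AC_of_hasDerivAt hI hIo.measurableSet hd ?_⟩
  exact ((hF.deriv hU).continuousOn).comp Complex.continuous_ofReal.continuousOn hIU

lemma AC_and_AC_deriv_of_differentiableOn {F : ℂ → ℂ} {U : Set ℂ} (hU : IsOpen U)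
    (hF : DifferentiableOn ℂ F U) {f : ℝ → ℂ} {I : Set ℝ} (hI : I.OrdConnected) (hIo : IsOpen I)
    (hIU : ∀ t ∈ I, (t : ℂ) ∈ U) (hf : ∀ t ∈ I, f t = F t) : AC f I ∧ AC (deriv f) I := by
  have h := deriv_and_AC_of_differentiableOn hU hF hI hIo hIU hf
  exact ⟨h.2, (deriv_and_AC_of_differentiableOn hU (hF.deriv hU) hI hIo hIU h.1).2⟩

lemma isOpen_timeInterval (T : EReal) : IsOpen (timeInterval T) :=
  (isOpen_lt continuous_const continuous_id).inter
    (isOpen_lt continuous_coe_real_ereal continuous_const)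

lemma ordConnected_timeInterval (T : EReal) : (timeInterval T).OrdConnected := by
  refine ⟨fun x hx y hy z hz => ⟨hx.1.trans_le hz.1, ?_⟩⟩
  exact (EReal.coe_le_coe_iff.2 hz.2).trans_lt hy.2

/-! ### The order `ν`. -/

lemma order_sq (lam : ℝ) : order lam ^ 2 = ((1 / 4 + lam : ℝ) : ℂ) := by
  simp [order, Complex.sqrt]

lemma order_re (lam : ℝ) : (order lam).re = Real.sqrt ((|1 / 4 + lam| + (1 / 4 + lam)) / 2) := by
  rw [order, Complex.sqrt, Complex.cpow_inv_two_re, Complex.norm_real, Complex.ofReal_re,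
    Real.norm_eq_abs]

lemma order_re_nonneg (lam : ℝ) : 0 ≤ (order lam).re := by
  rw [order_re]; exact Real.sqrt_nonneg _

/-- This is where `λ < 0` enters: it makes `Re (ν - 1/2)` strictly negative, on which both the
bounds and the vanishing at `x = 0` depend. -/
lemma order_re_lt {lam : ℝ} (hlam : lam < 0) : (order lam).re < 1 / 2 := by
  rw [order_re, Real.sqrt_lt' (by norm_num)]
  rcases abs_cases (1 / 4 + lam) with h | h <;> linarith

lemma order_im_eq_zero {lam : ℝ} (h : -(1 / 4) ≤ lam) : (order lam).im = 0 := by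
  have h0 : 0 ≤ 1 / 4 + lam := by linarith
  have : order lam = (((1 / 4 + lam) ^ (2⁻¹ : ℝ) : ℝ) : ℂ) := by
    rw [order, Complex.sqrt, Complex.ofReal_cpow h0]
    norm_num
  rw [this, Complex.ofReal_im]

lemma order_re_eq_zero {lam : ℝ} (h : lam < -(1 / 4)) : (order lam).re = 0 := by
  rw [order_re, abs_of_neg (by linarith), neg_add_cancel, zero_div, Real.sqrt_zero]

/-! ### The continued kernel. -/

/-- The constant `1 / (2 √(iπ) Γ(ν + 1/2))`. -/
def kernelConst (ν : ℂ) : ℂ :=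
  (2 * Complex.sqrt (Complex.I * Real.pi) * Complex.Gamma (ν + 1 / 2))⁻¹

/-- The profile `(2 √(iπ) Γ(ν+1/2))⁻¹ τ^{-1/2} k(i ξ z / (2τ))` for complex time and position. -/
def profile (ν τ ξ z : ℂ) : ℂ :=
  kernelConst ν * τ ^ (-(1 / 2) : ℂ) *
    laplaceInt (ν - 1 / 2) (ν - 1 / 2) (Complex.I * ξ * z / (2 * τ))

/-- The continuation of the kernel: `e^{i(z-x)²/(4t)}` times the profile if `x` and `z` lie on
the same side of the imaginary axis, and `0` otherwise. -/
def greenExt (ν : ℂ) (t x : ℝ) (z : ℂ) : ℂ :=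
  if 0 < x * z.re then
    Complex.exp (Complex.I * (z - x) ^ 2 / (4 * t)) * profile ν t x z
  else 0

lemma sqrt_I_mul_pi :
    Complex.sqrt (Complex.I * Real.pi) = Complex.I ^ (1 / 2 : ℂ) * (Real.sqrt Real.pi : ℂ) := by
  rw [Complex.sqrt, I_mul_ofReal_cpow Real.pi_pos, ofReal_sqrt_eq_cpow Real.pi_pos.le]
  norm_num

lemma sqrt_I_mul_pi_ne_zero : Complex.sqrt (Complex.I * Real.pi) ≠ 0 := by
  rw [sqrt_I_mul_pi]
  refine mul_ne_zero ?_ (Complex.ofReal_ne_zero.2 (Real.sqrt_pos.2 Real.pi_pos).ne')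
  rw [Complex.cpow_def_of_ne_zero Complex.I_ne_zero]
  exact Complex.exp_ne_zero _

lemma ofReal_cpow_neg_half {t : ℝ} (ht : 0 ≤ t) :
    (t : ℂ) ^ (-(1 / 2) : ℂ) = ((Real.sqrt t : ℝ) : ℂ)⁻¹ := by
  rw [Complex.cpow_neg, ofReal_sqrt_eq_cpow ht]

/-- With `w = xy/(2t)`, the factor `e^{-iw}` from Hankel's integral completes the square in the
Gaussian, and `√(xy) = √2 √t √w` provides the `√w` that the integral requires. -/
lemma greenExt_ofReal {lam : ℝ} (hlam : lam < 0) {t x y : ℝ} (ht : 0 < t) :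
    greenExt (order lam) t x y = greenFunction lam t x y := by
  rw [greenExt, greenFunction, step, Complex.ofReal_re]
  split_ifs with h
  · have hν : -(1 / 2) < (order lam).re := by linarith [order_re_nonneg lam]
    have hw : 0 < x * y / (2 * t) := by positivity
    have hH := sqrt_mul_hankelH2 hν (order_re_lt hlam) hw
    set ν := order lam
    have hst : (Real.sqrt t : ℂ) ≠ 0 := Complex.ofReal_ne_zero.2 (Real.sqrt_pos.2 ht).ne'
    have ht0 : (t : ℂ) ≠ 0 := Complex.ofReal_ne_zero.2 ht.ne'
    have hst2 : (t : ℂ) = (Real.sqrt t : ℂ) ^ 2 := by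
      rw [← Complex.ofReal_pow, Real.sq_sqrt ht.le]
    have h22 : (Real.sqrt 2 : ℂ) ^ 2 = 2 := by
      rw [← Complex.ofReal_pow, Real.sq_sqrt zero_le_two]; norm_num
    have hπ : (Real.sqrt Real.pi : ℂ) ≠ 0 :=
      Complex.ofReal_ne_zero.2 (Real.sqrt_pos.2 Real.pi_pos).ne'
    have hI : Complex.I ^ (1 / 2 : ℂ) ≠ 0 := by simp [Complex.cpow_eq_zero_iff]
    have hI2 : Complex.I ^ (ν + 1 / 2 : ℂ) ≠ 0 := by simp [Complex.cpow_eq_zero_iff]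
    have hI3 : Complex.I ^ (ν + 1) = Complex.I ^ (ν + 1 / 2) * Complex.I ^ (1 / 2 : ℂ) := by
      rw [← Complex.cpow_add _ _ Complex.I_ne_zero]; ring_nf
    have hsq : ((1 * Real.sqrt (x * y) : ℝ) : ℂ) =
        (Real.sqrt 2 : ℂ) * (Real.sqrt t : ℂ) * (Real.sqrt (x * y / (2 * t)) : ℂ) := by
      rw [one_mul, ← Complex.ofReal_mul, ← Complex.ofReal_mul, ← Real.sqrt_mul zero_le_two,
        ← Real.sqrt_mul (by positivity)]
      congr 2
      field_simp
    have hwc : ((x * y / (2 * t) : ℝ) : ℂ) = (x : ℂ) * y / (2 * t) := by push_cast; rfl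
    rw [hwc] at hH
    have hz : Complex.I * ((x : ℂ) * y / (2 * t)) = Complex.I * x * y / (2 * t) := by ring
    have hexp : Complex.exp (Complex.I * ((y : ℂ) - x) ^ 2 / (4 * t)) =
        Complex.exp (-((x : ℂ) ^ 2 + (y : ℂ) ^ 2) / (4 * Complex.I * t)) *
          Complex.exp (-(Complex.I * x * y / (2 * t))) := by
      rw [← Complex.exp_add]
      congr 1
      field_simp
      rw [Complex.I_sq]
      ring
    rw [hsq, profile, kernelConst, sqrt_I_mul_pi, ofReal_cpow_neg_half ht.le, hexp]
    rw [decaying, hz, hankelConst] at hH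
    rw [hI3]
    calc _ = (Real.sqrt 2 : ℂ) * (Real.sqrt t : ℂ) /
          (4 * (Complex.I ^ (ν + 1 / 2) * Complex.I ^ (1 / 2 : ℂ)) * t) *
          Complex.exp (-((x : ℂ) ^ 2 + (y : ℂ) ^ 2) / (4 * Complex.I * t)) *
          ((Real.sqrt (x * y / (2 * t)) : ℂ) * hankelH2 ν ((x : ℂ) * y / (2 * t))) := by
          rw [hH]
          generalize Complex.exp (-((x : ℂ) ^ 2 + (y : ℂ) ^ 2) / (4 * Complex.I * t)) = e1
          generalize Complex.exp (-(Complex.I * x * y / (2 * t))) = e2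
          generalize laplaceInt (ν - 1 / 2) (ν - 1 / 2) (Complex.I * x * y / (2 * t)) = L
          generalize Complex.Gamma (ν + 1 / 2) = Γ'
          generalize Complex.I ^ (ν + 1 / 2 : ℂ) = p at *
          generalize Complex.I ^ (1 / 2 : ℂ) = r at *
          rw [hst2]
          field_simp
          rw [h22]
          ring
      _ = _ := by ring
  · simp

/-! ### Derivatives of the profile and the Schrödinger equation. -/

/-- The derivative of `laplaceInt q q`. -/
def laplaceDeriv (q s : ℂ) : ℂ := q / s * (laplaceInt q (q - 1) s - laplaceInt q q s)

/-- The second derivative of `laplaceInt q q`. -/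
def laplaceDerivTwo (q s : ℂ) : ℂ := 2 * laplaceDeriv q s + q * (q + 1) / s ^ 2 * laplaceInt q q s

/-- The differential equation alone leaves `2 s² k'`, which the ray bounds do not control for large
`s`. The recurrence trades it for a combination of integrals that are all bounded. -/
lemma sq_mul_laplaceDerivTwo {q s : ℂ} (hq : -1 < q.re) (hq0 : q.re ≤ 0)
    (hs : s ∈ Complex.slitPlane) :
    s ^ 2 * laplaceDerivTwo q s = q * ((q - 1) * laplaceInt q (q - 2) s
      - 2 * q * laplaceInt q (q - 1) s + (q + 1) * laplaceInt q q s) := by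
  have hs0 : s ≠ 0 := Complex.slitPlane_ne_zero hs
  have h := laplaceInt_recurrence hq hq0 hs
  rw [laplaceDerivTwo, laplaceDeriv]
  field_simp
  linear_combination q * h

/-- A bound on `s k'(s)`, uniform over `RayBound c`. -/
def laplaceDerivBound (q : ℂ) (c : ℝ) : ℝ := ‖q‖ * (laplaceBound q (q - 1) c + laplaceBound q q c)

/-- A bound on `s² k''(s)`, uniform over `RayBound c`. -/
def laplaceDerivTwoBound (q : ℂ) (c : ℝ) : ℝ :=
  ‖q‖ * (‖q - 1‖ * laplaceBound q (q - 2) c + ‖2 * q‖ * laplaceBound q (q - 1) c +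
    ‖q + 1‖ * laplaceBound q q c)

lemma norm_mul_laplaceDeriv_le {c : ℝ} (hc : 0 < c) {q s : ℂ} (hq : -1 < q.re) (hq0 : q.re ≤ 0)
    (hs0 : s ≠ 0) (hs : RayBound c s) : ‖s * laplaceDeriv q s‖ ≤ laplaceDerivBound q c := by
  have e : s * laplaceDeriv q s = q * (laplaceInt q (q - 1) s - laplaceInt q q s) := by
    rw [laplaceDeriv]; field_simp
  rw [e, norm_mul, laplaceDerivBound]
  refine mul_le_mul_of_nonneg_left ((norm_sub_le _ _).trans (add_le_add ?_ ?_)) (norm_nonneg _)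
  · exact norm_laplaceInt_le hc hq (by simp; linarith) hs
  · exact norm_laplaceInt_le hc hq hq0 hs

lemma norm_sq_mul_laplaceDerivTwo_le {c : ℝ} (hc : 0 < c) {q s : ℂ} (hq : -1 < q.re)
    (hq0 : q.re ≤ 0) (hs0 : s ∈ Complex.slitPlane) (hs : RayBound c s) :
    ‖s ^ 2 * laplaceDerivTwo q s‖ ≤ laplaceDerivTwoBound q c := by
  rw [sq_mul_laplaceDerivTwo hq hq0 hs0, norm_mul, laplaceDerivTwoBound]
  refine mul_le_mul_of_nonneg_left ?_ (norm_nonneg _)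
  refine (norm_add_le _ _).trans (add_le_add ((norm_sub_le _ _).trans (add_le_add ?_ ?_)) ?_) <;>
    rw [norm_mul] <;> refine mul_le_mul_of_nonneg_left ?_ (norm_nonneg _)
  · exact norm_laplaceInt_le hc hq (by simp; linarith) hs
  · exact norm_laplaceInt_le hc hq (by simp; linarith) hs
  · exact norm_laplaceInt_le hc hq hq0 hs

lemma laplaceDerivBound_nonneg {q : ℂ} (hq : -1 < q.re) {c : ℝ} (hc : 0 < c) :
    0 ≤ laplaceDerivBound q c :=
  mul_nonneg (norm_nonneg _)
    (add_nonneg (laplaceBound_nonneg hq _ hc) (laplaceBound_nonneg hq _ hc))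

lemma laplaceDerivTwoBound_nonneg {q : ℂ} (hq : -1 < q.re) {c : ℝ} (hc : 0 < c) :
    0 ≤ laplaceDerivTwoBound q c := by
  have h1 := laplaceBound_nonneg hq (q - 2) hc
  have h2 := laplaceBound_nonneg hq (q - 1) hc
  have h3 := laplaceBound_nonneg hq q hc
  unfold laplaceDerivTwoBound
  positivity

lemma I_mul_div_im (t x : ℝ) (z : ℂ) :
    (Complex.I * (x : ℂ) * z / (2 * (t : ℂ))).im = x * z.re / (2 * t) := by
  rw [show Complex.I * (x : ℂ) * z / (2 * (t : ℂ)) = Complex.I * (((x / (2 * t) : ℝ) : ℂ) * z) by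
    push_cast; ring, Complex.I_mul_im, Complex.re_ofReal_mul]
  ring

lemma I_mul_div_mem_slitPlane {t x : ℝ} {z : ℂ} (ht : 0 < t) (h : 0 < x * z.re) :
    Complex.I * (x : ℂ) * z / (2 * (t : ℂ)) ∈ Complex.slitPlane := by
  rw [Complex.mem_slitPlane_iff, I_mul_div_im]
  right
  positivity

lemma hasDerivAt_profile_space {ν : ℂ} (hν : -(1 / 2) < ν.re) (hν' : ν.re < 1 / 2)
    {τ ξ z : ℂ} (hs : Complex.I * ξ * z / (2 * τ) ∈ Complex.slitPlane) :
    HasDerivAt (fun ξ => profile ν τ ξ z) (kernelConst ν * τ ^ (-(1 / 2) : ℂ) *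
      (laplaceDeriv (ν - 1 / 2) (Complex.I * ξ * z / (2 * τ)) * (Complex.I * z / (2 * τ)))) ξ := by
  have h1 : HasDerivAt (fun ξ : ℂ => Complex.I * ξ * z / (2 * τ)) (Complex.I * z / (2 * τ)) ξ := by
    refine ((((hasDerivAt_id ξ).const_mul Complex.I).mul_const z).div_const (2 * τ)).congr_deriv ?_
    ring
  have h2 : HasDerivAt (laplaceInt (ν - 1 / 2) (ν - 1 / 2))
      (laplaceDeriv (ν - 1 / 2) (Complex.I * ξ * z / (2 * τ))) (Complex.I * ξ * z / (2 * τ)) :=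
    hasDerivAt_laplaceInt (by simp; linarith) (by simp; linarith) hs
  exact (h2.comp ξ h1).const_mul _

lemma hasDerivAt_profile_space_deriv {ν : ℂ} (hν : -(1 / 2) < ν.re) (hν' : ν.re < 1 / 2)
    {τ ξ z : ℂ}
    (hs : Complex.I * ξ * z / (2 * τ) ∈ Complex.slitPlane) :
    HasDerivAt (fun ξ => kernelConst ν * τ ^ (-(1 / 2) : ℂ) *
      (laplaceDeriv (ν - 1 / 2) (Complex.I * ξ * z / (2 * τ)) * (Complex.I * z / (2 * τ))))
      (kernelConst ν * τ ^ (-(1 / 2) : ℂ) *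
      (laplaceDerivTwo (ν - 1 / 2) (Complex.I * ξ * z / (2 * τ)) *
        (Complex.I * z / (2 * τ)) ^ 2)) ξ := by
  have h1 : HasDerivAt (fun ξ : ℂ => Complex.I * ξ * z / (2 * τ)) (Complex.I * z / (2 * τ)) ξ := by
    refine ((((hasDerivAt_id ξ).const_mul Complex.I).mul_const z).div_const (2 * τ)).congr_deriv ?_
    ring
  have h2 : HasDerivAt (laplaceDeriv (ν - 1 / 2))
      (laplaceDerivTwo (ν - 1 / 2) (Complex.I * ξ * z / (2 * τ))) (Complex.I * ξ * z / (2 * τ)) :=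
    hasDerivAt_deriv_laplaceInt (by simp; linarith) (by simp; linarith) hs
  refine (((h2.comp ξ h1).mul_const (Complex.I * z / (2 * τ))).const_mul
    (kernelConst ν * τ ^ (-(1 / 2) : ℂ))).congr_deriv ?_
  ring

lemma hasDerivAt_profile_time {ν : ℂ} (hν : -(1 / 2) < ν.re) (hν' : ν.re < 1 / 2)
    {τ ξ z : ℂ} (hτ : τ ∈ Complex.slitPlane)
    (hs : Complex.I * ξ * z / (2 * τ) ∈ Complex.slitPlane) :
    HasDerivAt (fun τ => profile ν τ ξ z) (kernelConst ν * τ ^ (-(1 / 2) : ℂ) *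
      (-(1 / (2 * τ)) * laplaceInt (ν - 1 / 2) (ν - 1 / 2) (Complex.I * ξ * z / (2 * τ)) -
        1 / τ * (Complex.I * ξ * z / (2 * τ) *
          laplaceDeriv (ν - 1 / 2) (Complex.I * ξ * z / (2 * τ))))) τ := by
  have hτ0 : τ ≠ 0 := Complex.slitPlane_ne_zero hτ
  have h1 : HasDerivAt (fun τ : ℂ => Complex.I * ξ * z / (2 * τ))
      (-(1 / τ) * (Complex.I * ξ * z / (2 * τ))) τ := by
    refine ((((hasDerivAt_id τ).const_mul 2).inv (mul_ne_zero two_ne_zero hτ0)).const_mul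
      (Complex.I * ξ * z)).congr_deriv ?_
    simp only [id]
    field_simp
  have h2 : HasDerivAt (laplaceInt (ν - 1 / 2) (ν - 1 / 2))
      (laplaceDeriv (ν - 1 / 2) (Complex.I * ξ * z / (2 * τ))) (Complex.I * ξ * z / (2 * τ)) :=
    hasDerivAt_laplaceInt (by simp; linarith) (by simp; linarith) hs
  have h3 : HasDerivAt (fun τ : ℂ => τ ^ (-(1 / 2) : ℂ))
      (-(1 / 2) * τ ^ (-(1 / 2) - 1 : ℂ) * 1) τ := (hasDerivAt_id τ).cpow_const hτ
  refine ((h3.const_mul (kernelConst ν)).mul (h2.comp τ h1)).congr_deriv ?_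
  rw [Function.comp_apply, cpow_eq_cpow_sub_one_mul hτ0 (-(1 / 2) : ℂ)]
  field_simp
  ring

lemma hasDerivAt_gaussian_space (τ ξ z : ℂ) :
    HasDerivAt (fun ξ => Complex.exp (Complex.I * (z - ξ) ^ 2 / (4 * τ)))
      (Complex.exp (Complex.I * (z - ξ) ^ 2 / (4 * τ)) * (-(Complex.I * (z - ξ) / (2 * τ)))) ξ := by
  refine ((((((hasDerivAt_id ξ).const_sub z).pow 2).const_mul Complex.I).div_const
    (4 * τ)).cexp).congr_deriv ?_
  simp only [id, Pi.pow_apply]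
  push_cast
  ring

lemma hasDerivAt_gaussian_time {τ : ℂ} (hτ : τ ≠ 0) (ξ z : ℂ) :
    HasDerivAt (fun τ => Complex.exp (Complex.I * (z - ξ) ^ 2 / (4 * τ)))
      (Complex.exp (Complex.I * (z - ξ) ^ 2 / (4 * τ)) *
        (-(Complex.I * (z - ξ) ^ 2 / (4 * τ ^ 2)))) τ := by
  have h : HasDerivAt (fun τ : ℂ => Complex.I * (z - ξ) ^ 2 / (4 * τ))
      (-(Complex.I * (z - ξ) ^ 2 / (4 * τ ^ 2))) τ := by
    refine ((((hasDerivAt_id τ).const_mul 4).inv (mul_ne_zero (by norm_num : (4 : ℂ) ≠ 0) hτ)).const_mul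
      (Complex.I * (z - ξ) ^ 2)).congr_deriv ?_
    simp only [id]
    field_simp
  exact h.cexp

lemma eventually_pos_mul {x r : ℝ} (h : 0 < x * r) : ∀ᶠ ξ : ℝ in 𝓝 x, 0 < ξ * r :=
  (isOpen_lt continuous_const (continuous_id.mul continuous_const)).mem_nhds h

lemma eventually_not_pos_mul {x r : ℝ} (h : x * r < 0) : ∀ᶠ ξ : ℝ in 𝓝 x, ¬ 0 < ξ * r := by
  filter_upwards [(isOpen_lt (continuous_id.mul continuous_const) continuous_const).mem_nhds h]
    with ξ hξ
  exact not_lt.2 (le_of_lt hξ)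

/-- On the opposite side of the imaginary axis the kernel is locally zero. On the same side, the
Gaussian factor reduces the equation to the one for `k`, whose coefficient is `q(q+1) = ν² - 1/4`.
-/
lemma greenExt_schroedinger {ν : ℂ} (hν : -(1 / 2) < ν.re) (hν' : ν.re < 1 / 2)
    {t x : ℝ} (ht : 0 < t) (hx : x ≠ 0) {z : ℂ} (hz : z.re ≠ 0) :
    DifferentiableAt ℝ (fun τ => greenExt ν τ x z) t ∧
    DifferentiableAt ℝ (fun ξ => greenExt ν t ξ z) x ∧
    DifferentiableAt ℝ (deriv fun ξ => greenExt ν t ξ z) x ∧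
    Complex.I * deriv (fun τ => greenExt ν τ x z) t =
      -deriv (deriv fun ξ => greenExt ν t ξ z) x + (ν ^ 2 - 1 / 4) / x ^ 2 * greenExt ν t x z := by
  have ht0 : (t : ℂ) ≠ 0 := Complex.ofReal_ne_zero.2 ht.ne'
  have hx0 : (x : ℂ) ≠ 0 := Complex.ofReal_ne_zero.2 hx
  have hz0 : z ≠ 0 := fun h => hz (by simp [h])
  rcases lt_or_gt_of_ne (mul_ne_zero hx hz) with h | h
  · have e1 : (fun ξ => greenExt ν t ξ z) =ᶠ[𝓝 x] fun _ => 0 := by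
      filter_upwards [eventually_not_pos_mul h] with ξ hξ
      rw [greenExt, if_neg hξ]
    have e2 : (fun τ => greenExt ν τ x z) = fun _ => 0 := by
      funext τ
      rw [greenExt, if_neg (not_lt.2 h.le)]
    have e3 := e1.deriv
    simp only [deriv_const'] at e3
    refine ⟨?_, ?_, ?_, ?_⟩
    · rw [e2]; exact differentiableAt_const _
    · exact e1.differentiableAt_iff.2 (differentiableAt_const _)
    · exact e3.differentiableAt_iff.2 (differentiableAt_const _)
    · rw [e2, e3.deriv_eq, e1.eq_of_nhds]
      simp
  · have hF : ∀ ξ : ℝ, 0 < ξ * z.re → HasDerivAt (fun ξ : ℝ => greenExt ν t ξ z)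
        (Complex.exp (Complex.I * (z - ξ) ^ 2 / (4 * t)) * (-(Complex.I * (z - ξ) / (2 * t))) *
          profile ν t ξ z + Complex.exp (Complex.I * (z - ξ) ^ 2 / (4 * t)) *
          (kernelConst ν * (t : ℂ) ^ (-(1 / 2) : ℂ) * (laplaceDeriv (ν - 1 / 2)
            (Complex.I * ξ * z / (2 * t)) * (Complex.I * z / (2 * t))))) ξ := by
      intro ξ hξ
      have h1 := ((hasDerivAt_gaussian_space t ξ z).mul
        (hasDerivAt_profile_space hν hν' (I_mul_div_mem_slitPlane ht hξ))).comp_ofReal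
      refine h1.congr_of_eventuallyEq ?_
      filter_upwards [eventually_pos_mul hξ] with η hη
      rw [greenExt, if_pos hη]
      rfl
    have e1 : (deriv fun ξ => greenExt ν t ξ z) =ᶠ[𝓝 x] fun ξ : ℝ =>
        Complex.exp (Complex.I * (z - ξ) ^ 2 / (4 * t)) * (-(Complex.I * (z - ξ) / (2 * t))) *
          profile ν t ξ z + Complex.exp (Complex.I * (z - ξ) ^ 2 / (4 * t)) *
          (kernelConst ν * (t : ℂ) ^ (-(1 / 2) : ℂ) * (laplaceDeriv (ν - 1 / 2)
            (Complex.I * ξ * z / (2 * t)) * (Complex.I * z / (2 * t)))) := by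
      filter_upwards [eventually_pos_mul h] with ξ hξ
      exact (hF ξ hξ).deriv
    have d1 : HasDerivAt (fun ξ : ℂ => -(Complex.I * (z - ξ) / (2 * t))) (Complex.I / (2 * t))
        (x : ℂ) := by
      refine (((((hasDerivAt_id (x : ℂ)).const_sub z).const_mul Complex.I).div_const
        (2 * (t : ℂ))).neg).congr_deriv ?_
      ring
    have hs := I_mul_div_mem_slitPlane ht h
    have hs0 := Complex.slitPlane_ne_zero hs
    have d2 := ((((hasDerivAt_gaussian_space t x z).mul d1).mul
      (hasDerivAt_profile_space hν hν' hs)).add ((hasDerivAt_gaussian_space t x z).mul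
      (hasDerivAt_profile_space_deriv hν hν' hs))).comp_ofReal
    have d3 := d2.congr_of_eventuallyEq e1
    have d4 := ((hasDerivAt_gaussian_time ht0 x z).mul (hasDerivAt_profile_time hν hν'
      (Complex.ofReal_mem_slitPlane.2 ht) hs)).comp_ofReal
    have e2 : (fun τ => greenExt ν τ x z) = fun τ : ℝ =>
        ((fun τ : ℂ => Complex.exp (Complex.I * (z - x) ^ 2 / (4 * τ))) *
          fun τ : ℂ => profile ν τ x z) (τ : ℂ) := by
      funext τ
      rw [greenExt, if_pos h]
      rfl
    rw [← e2] at d4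
    refine ⟨d4.differentiableAt, (hF x h).differentiableAt, d3.differentiableAt, ?_⟩
    rw [d4.deriv, d3.deriv, greenExt, if_pos h]
    -- Unfolding `laplaceDerivTwo` substitutes the differential equation for `k''`; what remains is
    -- an algebraic identity in `k`, `k'` and the Gaussian.
    simp only [profile, laplaceDerivTwo, Pi.mul_apply]
    generalize Complex.exp (Complex.I * (z - x) ^ 2 / (4 * t)) = E
    generalize laplaceDeriv (ν - 1 / 2) (Complex.I * x * z / (2 * t)) = K1
    generalize laplaceInt (ν - 1 / 2) (ν - 1 / 2) (Complex.I * x * z / (2 * t)) = K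
    generalize (t : ℂ) ^ (-(1 / 2) : ℂ) = r
    field_simp
    ring

/-! ### Regularity, boundary values and the initial condition. -/

lemma differentiableAt_laplaceInt {ν : ℂ} (hν : -(1 / 2) < ν.re) (hν' : ν.re < 1 / 2) {s : ℂ}
    (hs : s ∈ Complex.slitPlane) :
    DifferentiableAt ℂ (laplaceInt (ν - 1 / 2) (ν - 1 / 2)) s :=
  (hasDerivAt_laplaceInt (by simp; linarith) (by simp; linarith) hs).differentiableAt

lemma differentiableAt_greenExt {ν : ℂ} (hν : -(1 / 2) < ν.re) (hν' : ν.re < 1 / 2) {t x : ℝ}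
    (ht : 0 < t) (hx : x ≠ 0) {z : ℂ} (hz : z.re ≠ 0) :
    DifferentiableAt ℂ (greenExt ν t x) z := by
  rcases lt_or_gt_of_ne (mul_ne_zero hx hz) with h | h
  · have e : greenExt ν t x =ᶠ[𝓝 z] fun _ => 0 := by
      filter_upwards [(isOpen_lt (continuous_const.mul Complex.continuous_re)
        continuous_const).mem_nhds h] with w hw
      have hw' : x * w.re < 0 := hw
      rw [greenExt, if_neg (not_lt.2 hw'.le)]
    exact e.differentiableAt_iff.2 (differentiableAt_const _)
  · have e : greenExt ν t x =ᶠ[𝓝 z] fun w =>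
        Complex.exp (Complex.I * (w - x) ^ 2 / (4 * t)) * profile ν t x w := by
      filter_upwards [(isOpen_lt continuous_const
        (continuous_const.mul Complex.continuous_re)).mem_nhds h] with w hw
      have hw' : 0 < x * w.re := hw
      rw [greenExt, if_pos hw']
    refine e.differentiableAt_iff.2 (DifferentiableAt.mul (by fun_prop) ?_)
    refine DifferentiableAt.const_mul ?_ _
    exact (differentiableAt_laplaceInt hν hν' (I_mul_div_mem_slitPlane ht h)).comp z
      (f := fun w : ℂ => Complex.I * x * w / (2 * t)) (by fun_prop)

lemma AC_zero {f : ℝ → ℂ} {I : Set ℝ} (h : ∀ t ∈ I, f t = 0) : AC f I := by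
  refine ⟨fun _ => 0, locallyIntegrable_zero.locallyIntegrableOn _, fun x hx y hy => ?_⟩
  simp [h x hx, h y hy]

/-- Where it is not zero, the kernel extends holomorphically in complex time and in complex
position, so its derivatives are automatically continuous. -/
lemma AC12_greenExt {ν : ℂ} (hν : -(1 / 2) < ν.re) (hν' : ν.re < 1 / 2) (T : EReal) {z : ℂ}
    (hz : z.re ≠ 0) : AC12 T (fun t x => greenExt ν t x z) := by
  have hspace : ∀ t : ℝ, 0 < t → ∀ I : Set ℝ, I.OrdConnected → IsOpen I →
      ((∀ x ∈ I, 0 < x * z.re) ∨ ∀ x ∈ I, x * z.re < 0) →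
      AC (fun x => greenExt ν t x z) I ∧ AC (deriv fun x => greenExt ν t x z) I := by
    intro t ht I hI hIo hsign
    rcases hsign with h | h
    · set U : Set ℂ := {ξ | Complex.I * ξ * z / (2 * t) ∈ Complex.slitPlane}
      have hU : IsOpen U := Complex.isOpen_slitPlane.preimage
        (f := fun ξ : ℂ => Complex.I * ξ * z / (2 * t)) (by fun_prop)
      refine AC_and_AC_deriv_of_differentiableOn hU (F := fun ξ =>
        Complex.exp (Complex.I * (z - ξ) ^ 2 / (4 * t)) * profile ν t ξ z) ?_ hI hIo
        (fun x hx => I_mul_div_mem_slitPlane ht (h x hx)) (fun x hx => ?_)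
      · intro ξ hξ
        exact ((hasDerivAt_gaussian_space t ξ z).mul
          (hasDerivAt_profile_space hν hν' hξ)).differentiableAt.differentiableWithinAt
      · rw [greenExt, if_pos (h x hx)]
    · have h0 : ∀ x ∈ I, greenExt ν t x z = 0 := fun x hx => by
        rw [greenExt, if_neg (not_lt.2 (h x hx).le)]
      refine ⟨AC_zero h0, AC_zero fun x hx => ?_⟩
      have e : (fun x => greenExt ν t x z) =ᶠ[𝓝 x] fun _ => 0 := by
        filter_upwards [hIo.mem_nhds hx] with y hy using h0 y hy
      rw [e.deriv_eq, deriv_const]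
  refine ⟨fun x hx => ?_, fun t ht => ?_⟩
  · rcases lt_or_gt_of_ne (mul_ne_zero hx hz) with h | h
    · exact AC_zero fun t _ => if_neg (not_lt.2 h.le)
    · set U : Set ℂ := Complex.slitPlane ∩
        (fun τ : ℂ => Complex.I * x * z / (2 * τ)) ⁻¹' Complex.slitPlane
      have hU : IsOpen U := by
        refine ContinuousOn.isOpen_inter_preimage ?_ Complex.isOpen_slitPlane
          Complex.isOpen_slitPlane
        intro τ hτ
        have hτ0 : 2 * τ ≠ 0 := mul_ne_zero two_ne_zero (Complex.slitPlane_ne_zero hτ)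
        exact (ContinuousAt.div (by fun_prop) (by fun_prop) hτ0).continuousWithinAt
      refine (deriv_and_AC_of_differentiableOn hU (F := fun τ =>
        Complex.exp (Complex.I * (z - x) ^ 2 / (4 * τ)) * profile ν τ x z) ?_
        (ordConnected_timeInterval T) (isOpen_timeInterval T)
        (fun t ht => ⟨Complex.ofReal_mem_slitPlane.2 ht.1, I_mul_div_mem_slitPlane ht.1 h⟩)
        (fun t ht => ?_)).2
      · intro τ hτ
        exact ((hasDerivAt_gaussian_time (Complex.slitPlane_ne_zero hτ.1) x z).mul
          (hasDerivAt_profile_time hν hν' hτ.1 hτ.2)).differentiableAt.differentiableWithinAt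
      · exact if_pos h
  · have hneg := hspace t ht.1 (Iio 0) ordConnected_Iio isOpen_Iio
    have hpos := hspace t ht.1 (Ioi 0) ordConnected_Ioi isOpen_Ioi
    rcases lt_or_gt_of_ne hz with h | h
    · have h1 := hneg (Or.inl fun x hx => mul_pos_of_neg_of_neg hx h)
      have h2 := hpos (Or.inr fun x hx => mul_neg_of_pos_of_neg hx h)
      exact ⟨⟨h1.1, h2.1⟩, ⟨h1.2, h2.2⟩⟩
    · have h1 := hneg (Or.inr fun x hx => mul_neg_of_neg_of_pos hx h)
      have h2 := hpos (Or.inl fun x hx => mul_pos hx h)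
      exact ⟨⟨h1.1, h2.1⟩, ⟨h1.2, h2.2⟩⟩

/-- On the side where the kernel is nonzero the Gaussian converges and `k(ixy/(2t)) → 0`. The
argument is purely imaginary, so the ray constant is `1`. -/
lemma tendsto_greenExt_zero {ν : ℂ} (hν : -(1 / 2) < ν.re) (hν' : ν.re < 1 / 2) {t y : ℝ}
    (ht : 0 < t) : Tendsto (fun x : ℝ => greenExt ν t x y) (𝓝[≠] 0) (𝓝 0) := by
  unfold greenExt
  refine Tendsto.if ?_ tendsto_const_nhds
  set l : Filter ℝ := 𝓝[≠] 0 ⊓ 𝓟 {x | 0 < x * (y : ℂ).re}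
  have hl0 : l ≤ 𝓝 0 := inf_le_left.trans nhdsWithin_le_nhds
  have hl : ∀ᶠ x in l, 0 < x * (y : ℂ).re := mem_inf_of_right (mem_principal_self _)
  have hk : Tendsto (fun x : ℝ => laplaceInt (ν - 1 / 2) (ν - 1 / 2)
      (Complex.I * x * y / (2 * t))) l (𝓝 0) := by
    refine tendsto_laplaceInt_zero one_pos (by simp; linarith) (by simp; linarith) ?_ ?_ ?_
    · filter_upwards [hl] with x hx using I_mul_div_mem_slitPlane ht hx
    · filter_upwards [hl] with x hx
      refine rayBound_one (le_of_eq ?_)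
        (Complex.slitPlane_ne_zero (I_mul_div_mem_slitPlane ht hx))
      rw [show Complex.I * (x : ℂ) * y / (2 * (t : ℂ)) =
        Complex.I * ((x * y / (2 * t) : ℝ) : ℂ) by push_cast; ring, Complex.I_mul_re,
        Complex.ofReal_im, neg_zero]
    · have hc : Continuous fun x : ℝ => Complex.I * (x : ℂ) * y / (2 * (t : ℂ)) := by fun_prop
      simpa using (hc.tendsto 0).mono_left hl0
  have hE : Tendsto (fun x : ℝ => Complex.exp (Complex.I * ((y : ℂ) - x) ^ 2 / (4 * t))) l
      (𝓝 (Complex.exp (Complex.I * ((y : ℂ) - (0 : ℝ)) ^ 2 / (4 * t)))) := by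
    have hc : Continuous fun x : ℝ =>
      Complex.exp (Complex.I * ((y : ℂ) - x) ^ 2 / (4 * (t : ℂ))) := by fun_prop
    exact (hc.tendsto 0).mono_left hl0
  simpa [profile] using hE.mul (hk.const_mul (kernelConst ν * (t : ℂ) ^ (-(1 / 2) : ℂ)))

lemma sqrt_one_div_four_mul (t : ℝ) :
    Real.sqrt (1 / (4 * t)) = (2 * Real.sqrt t)⁻¹ := by
  rw [one_div, Real.sqrt_inv, Real.sqrt_mul (by norm_num), show (4 : ℝ) = 2 ^ 2 by norm_num,
    Real.sqrt_sq zero_le_two]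

/-- On the diagonal the Gaussian is `1` and `ix²/(2t) → i∞`, so `k → Γ(ν + 1/2)`, which cancels
against `kernelConst`; the factor `2` comes from `√a = 1/(2√t)`. -/
lemma tendsto_greenExt_diagonal {ν : ℂ} (hν : -(1 / 2) < ν.re) (hν' : ν.re < 1 / 2) {x : ℝ}
    (hx : x ≠ 0) :
    Tendsto (fun t : ℝ => greenExt ν t x x / (Real.sqrt (1 / (4 * t)) : ℂ)) (𝓝[>] 0)
      (𝓝 (1 / Complex.sqrt (Complex.I * Real.pi))) := by
  have hxx : 0 < x * (x : ℂ).re := by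
    rw [Complex.ofReal_re]; exact mul_self_pos.2 hx
  have hk : Tendsto (fun t : ℝ => laplaceInt (ν - 1 / 2) (ν - 1 / 2)
      (Complex.I * x * x / (2 * t))) (𝓝[>] 0) (𝓝 (Complex.Gamma (ν - 1 / 2 + 1))) := by
    refine tendsto_laplaceInt_of_tendsto_inv one_pos (by simp; linarith) (by simp; linarith)
      ?_ ?_ ?_
    · filter_upwards [self_mem_nhdsWithin] with t ht using I_mul_div_mem_slitPlane ht hxx
    · filter_upwards [self_mem_nhdsWithin] with t ht
      refine rayBound_one (le_of_eq ?_)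
        (Complex.slitPlane_ne_zero (I_mul_div_mem_slitPlane ht hxx))
      rw [show Complex.I * (x : ℂ) * x / (2 * (t : ℂ)) =
        Complex.I * ((x * x / (2 * t) : ℝ) : ℂ) by push_cast; ring, Complex.I_mul_re,
        Complex.ofReal_im, neg_zero]
    · have hc : Continuous fun t : ℝ => (2 * (t : ℂ)) / (Complex.I * x * x) := by fun_prop
      have := (hc.tendsto 0).mono_left (nhdsWithin_le_nhds (s := Ioi 0))
      simp only [Complex.ofReal_zero, mul_zero, zero_div] at this
      exact this.congr fun t => (inv_div _ _).symm
  have h := hk.const_mul (2 * kernelConst ν)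
  have e : 2 * kernelConst ν * Complex.Gamma (ν - 1 / 2 + 1) =
      1 / Complex.sqrt (Complex.I * Real.pi) := by
    have hΓ : Complex.Gamma (ν + 1 / 2) ≠ 0 :=
      Complex.Gamma_ne_zero_of_re_pos (by simp; linarith)
    have hs := sqrt_I_mul_pi_ne_zero
    rw [show ν - 1 / 2 + 1 = ν + 1 / 2 by ring, kernelConst]
    generalize Complex.Gamma (ν + 1 / 2) = G at *
    generalize Complex.sqrt (Complex.I * Real.pi) = r at *
    field_simp
  rw [e] at h
  refine h.congr' ?_
  filter_upwards [self_mem_nhdsWithin] with t ht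
  have ht' : 0 < t := ht
  have hst : (Real.sqrt t : ℂ) ≠ 0 := Complex.ofReal_ne_zero.2 (Real.sqrt_pos.2 ht').ne'
  rw [greenExt, if_pos hxx, profile, sqrt_one_div_four_mul t, ofReal_cpow_neg_half ht'.le,
    sub_self]
  push_cast
  simp only [ne_eq, OfNat.ofNat_ne_zero, not_false_eq_true, zero_pow, mul_zero, zero_div,
    Complex.exp_zero, one_mul, div_inv_eq_mul]
  field_simp

/-! ### Uniform bounds on `D_{α,h}`. -/

lemma domainD_re {α h : ℝ} (hα : α ∈ Ioo (0 : ℝ) (Real.pi / 2)) {z : ℂ} (hz : z ∈ domainD α h) :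
    z ≠ 0 ∧ Real.cos α * ‖z‖ ≤ |z.re| := by
  have key : ∀ w : ℂ, Complex.arg w ∈ Icc (-α) α → Real.cos α * ‖w‖ ≤ w.re := by
    intro w hw
    rw [← Complex.norm_mul_cos_arg w, mul_comm, ← Real.cos_abs w.arg]
    refine mul_le_mul_of_nonneg_left ?_ (norm_nonneg _)
    exact Real.cos_le_cos_of_nonneg_of_le_pi (abs_nonneg _) (by linarith [hα.2, Real.pi_pos])
      (abs_le.2 hw)
  rcases hz with ⟨h0, h1, -⟩ | ⟨h0, h1, -⟩
  · exact ⟨h0, (key z h1).trans (le_abs_self _)⟩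
  · refine ⟨h0, ?_⟩
    have := key (-z) h1
    rw [norm_neg, Complex.neg_re] at this
    exact this.trans (neg_le_abs _)

lemma cos_pos_of_mem_Ioo {α : ℝ} (hα : α ∈ Ioo (0 : ℝ) (Real.pi / 2)) : 0 < Real.cos α :=
  Real.cos_pos_of_mem_Ioo ⟨by linarith [hα.1, Real.pi_pos], hα.2⟩

lemma domainD_re_ne_zero {α h : ℝ} (hα : α ∈ Ioo (0 : ℝ) (Real.pi / 2)) {z : ℂ}
    (hz : z ∈ domainD α h) : z.re ≠ 0 := by
  obtain ⟨h0, h1⟩ := domainD_re hα hz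
  exact abs_pos.1 ((mul_pos (cos_pos_of_mem_Ioo hα) (norm_pos_iff.2 h0)).trans_le h1)

/-- For `s = ixz/(2t)` one has `|Im s|/|s| = |Re z|/|z| ≥ cos α`, a constant independent of `t`, `x`
and `z`. -/
lemma rayBound_of_mem_domainD {α h : ℝ} (hα : α ∈ Ioo (0 : ℝ) (Real.pi / 2)) {z : ℂ}
    (hz : z ∈ domainD α h) {t x : ℝ} (ht : 0 < t) (hx : 0 < x * z.re) :
    RayBound (Real.cos α) (Complex.I * (x : ℂ) * z / (2 * (t : ℂ))) := by
  refine rayBound_of_im (Complex.slitPlane_ne_zero (I_mul_div_mem_slitPlane ht hx)) ?_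
  rw [I_mul_div_im, abs_div, abs_mul, norm_div, norm_mul, norm_mul, norm_mul, Complex.norm_I,
    Complex.norm_real, Complex.norm_real, Complex.norm_ofNat, one_mul, Real.norm_eq_abs,
    Real.norm_eq_abs, abs_of_pos ht, abs_of_pos (by positivity : 0 < 2 * t), ← mul_div_assoc]
  refine div_le_div_of_nonneg_right ?_ (by positivity)
  have := mul_le_mul_of_nonneg_left (domainD_re hα hz).2 (abs_nonneg x)
  linarith

lemma reduced_greenExt (ν : ℂ) {t : ℝ} (x : ℝ) (z : ℂ) :
    reduced (fun t => 1 / (4 * t)) (greenExt ν) t x z =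
      if 0 < x * z.re then profile ν t x z else 0 := by
  rw [reduced, greenExt]
  split_ifs
  · rw [← mul_assoc, ← Complex.exp_add]
    push_cast
    rw [show -(Complex.I * (1 / (4 * (t : ℂ))) * (z - x) ^ 2) + Complex.I * (z - x) ^ 2 / (4 * t)
      = 0 by ring, Complex.exp_zero, one_mul]
  · rw [mul_zero]

lemma norm_kernelConst_mul_cpow (ν : ℂ) {t : ℝ} (ht : 0 < t) :
    ‖kernelConst ν * (t : ℂ) ^ (-(1 / 2) : ℂ)‖ = ‖kernelConst ν‖ * (Real.sqrt t)⁻¹ := by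
  rw [norm_mul, ofReal_cpow_neg_half ht.le, norm_inv, Complex.norm_real,
    Real.norm_of_nonneg (Real.sqrt_nonneg _)]

lemma norm_reduced_le {ν : ℂ} (hν : -(1 / 2) < ν.re) (hν' : ν.re < 1 / 2) {α h : ℝ}
    (hα : α ∈ Ioo (0 : ℝ) (Real.pi / 2)) {t x : ℝ} (ht : 0 < t) {z : ℂ} (hz : z ∈ domainD α h) :
    ‖reduced (fun t => 1 / (4 * t)) (greenExt ν) t x z‖ ≤ ‖kernelConst ν‖ * (Real.sqrt t)⁻¹ *
      laplaceBound (ν - 1 / 2) (ν - 1 / 2) (Real.cos α) := by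
  have hq : -1 < (ν - 1 / 2).re := by simp; linarith
  have hq0 : (ν - 1 / 2).re ≤ 0 := by simp; linarith
  have hc := cos_pos_of_mem_Ioo hα
  have hM := laplaceBound_nonneg hq (ν - 1 / 2) hc
  rw [reduced_greenExt]
  split_ifs with hx
  · rw [profile, norm_mul, norm_kernelConst_mul_cpow ν ht]
    exact mul_le_mul_of_nonneg_left
      (norm_laplaceInt_le hc hq hq0 (rayBound_of_mem_domainD hα hz ht hx)) (by positivity)
  · rw [norm_zero]; positivity

/-- `k` depends on `x` and `t` only through `s`, which is proportional to `x/t`. Hence the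
derivatives are `s k'/x`, `s² k''/x²` and `-s k'/t`, together with a term from `t^{-1/2}`, and only
the scale-invariant bounds are needed. -/
lemma norm_deriv_reduced_le {ν : ℂ} (hν : -(1 / 2) < ν.re) (hν' : ν.re < 1 / 2) {α h : ℝ}
    (hα : α ∈ Ioo (0 : ℝ) (Real.pi / 2)) {t x : ℝ} (ht : 0 < t) (hx0 : x ≠ 0) {z : ℂ}
    (hz : z ∈ domainD α h) :
    ‖deriv (fun ξ => reduced (fun t => 1 / (4 * t)) (greenExt ν) t ξ z) x‖ ≤
      ‖kernelConst ν‖ * (Real.sqrt t)⁻¹ * (laplaceDerivBound (ν - 1 / 2) (Real.cos α) / |x|) ∧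
    ‖deriv (deriv fun ξ => reduced (fun t => 1 / (4 * t)) (greenExt ν) t ξ z) x‖ ≤
      ‖kernelConst ν‖ * (Real.sqrt t)⁻¹ *
        (laplaceDerivTwoBound (ν - 1 / 2) (Real.cos α) / x ^ 2) ∧
    ‖deriv (fun τ => reduced (fun t => 1 / (4 * t)) (greenExt ν) τ x z) t‖ ≤
      ‖kernelConst ν‖ * (Real.sqrt t)⁻¹ * ((laplaceBound (ν - 1 / 2) (ν - 1 / 2) (Real.cos α) +
        laplaceDerivBound (ν - 1 / 2) (Real.cos α)) / t) := by
  have hq : -1 < (ν - 1 / 2).re := by simp; linarith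
  have hq0 : (ν - 1 / 2).re ≤ 0 := by simp; linarith
  have hc := cos_pos_of_mem_Ioo hα
  have hM0 := laplaceBound_nonneg hq (ν - 1 / 2) hc
  have hM1 := laplaceDerivBound_nonneg hq hc
  have hM2 := laplaceDerivTwoBound_nonneg hq hc
  have hzr := domainD_re_ne_zero hα hz
  have hxc : (x : ℂ) ≠ 0 := Complex.ofReal_ne_zero.2 hx0
  have ht0 : (t : ℂ) ≠ 0 := Complex.ofReal_ne_zero.2 ht.ne'
  simp only [reduced_greenExt]
  rcases lt_or_gt_of_ne (mul_ne_zero hx0 hzr) with hx | hx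
  · have e1 : (fun ξ : ℝ => if 0 < ξ * z.re then profile ν t ξ z else 0) =ᶠ[𝓝 x] fun _ => 0 := by
      filter_upwards [eventually_not_pos_mul hx] with ξ hξ
      rw [if_neg hξ]
    have e2 := e1.deriv
    simp only [deriv_const'] at e2
    refine ⟨?_, ?_, ?_⟩
    · rw [e2.eq_of_nhds, norm_zero]; positivity
    · rw [e2.deriv_eq, deriv_const, norm_zero]; positivity
    · simp only [if_neg (not_lt.2 hx.le), deriv_const, norm_zero]; positivity
  · have hs := I_mul_div_mem_slitPlane ht hx
    have hs0 := Complex.slitPlane_ne_zero hs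
    have hray := rayBound_of_mem_domainD hα hz ht hx
    have hsx : Complex.I * z / (2 * (t : ℂ)) = Complex.I * x * z / (2 * (t : ℂ)) / x := by
      field_simp
    have d1 : ∀ ξ : ℝ, 0 < ξ * z.re → HasDerivAt
        (fun ξ : ℝ => if 0 < ξ * z.re then profile ν t ξ z else 0)
        (kernelConst ν * (t : ℂ) ^ (-(1 / 2) : ℂ) * (laplaceDeriv (ν - 1 / 2)
          (Complex.I * ξ * z / (2 * t)) * (Complex.I * z / (2 * t)))) ξ := by
      intro ξ hξ
      refine ((hasDerivAt_profile_space hν hν'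
        (I_mul_div_mem_slitPlane ht hξ)).comp_ofReal).congr_of_eventuallyEq ?_
      filter_upwards [eventually_pos_mul hξ] with η hη
      rw [if_pos hη]
    have e1 : (deriv fun ξ : ℝ => if 0 < ξ * z.re then profile ν t ξ z else 0) =ᶠ[𝓝 x]
        fun ξ : ℝ => kernelConst ν * (t : ℂ) ^ (-(1 / 2) : ℂ) * (laplaceDeriv (ν - 1 / 2)
          (Complex.I * ξ * z / (2 * t)) * (Complex.I * z / (2 * t))) := by
      filter_upwards [eventually_pos_mul hx] with ξ hξ using (d1 ξ hξ).deriv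
    have d2 := ((hasDerivAt_profile_space_deriv hν hν' hs).comp_ofReal).congr_of_eventuallyEq e1
    have d3 := (hasDerivAt_profile_time hν hν' (Complex.ofReal_mem_slitPlane.2 ht) hs).comp_ofReal
    have b0 := norm_laplaceInt_le hc hq hq0 hray
    have b1 := norm_mul_laplaceDeriv_le hc hq hq0 hs0 hray
    have b2 := norm_sq_mul_laplaceDerivTwo_le hc hq hq0 hs hray
    refine ⟨?_, ?_, ?_⟩
    · rw [(d1 x hx).deriv, norm_mul, norm_kernelConst_mul_cpow ν ht, hsx]
      refine mul_le_mul_of_nonneg_left ?_ (by positivity)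
      rw [← mul_div_assoc, norm_div, Complex.norm_real, Real.norm_eq_abs, mul_comm (laplaceDeriv _ _)]
      gcongr
    · rw [d2.deriv, norm_mul, norm_kernelConst_mul_cpow ν ht, hsx, div_pow]
      refine mul_le_mul_of_nonneg_left ?_ (by positivity)
      rw [← mul_div_assoc, norm_div, norm_pow, Complex.norm_real, Real.norm_eq_abs, sq_abs,
        mul_comm (laplaceDerivTwo _ _)]
      gcongr
    · simp only [if_pos hx]
      rw [d3.deriv, norm_mul, norm_kernelConst_mul_cpow ν ht]
      refine mul_le_mul_of_nonneg_left ?_ (by positivity)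
      refine (norm_sub_le _ _).trans ?_
      rw [add_div]
      refine add_le_add ?_ ?_
      · rw [norm_mul, norm_neg, norm_div, norm_one, norm_mul, Complex.norm_real,
          Complex.norm_ofNat, Real.norm_of_nonneg ht.le, div_eq_mul_inv _ t, mul_comm _ t⁻¹]
        refine mul_le_mul ?_ b0 (norm_nonneg _) (by positivity)
        rw [one_div, inv_le_inv₀ (by positivity) ht]
        linarith
      · rw [norm_mul, norm_div, norm_one, Complex.norm_real, Real.norm_of_nonneg ht.le,
          one_div, div_eq_mul_inv _ t, mul_comm _ t⁻¹]
        exact mul_le_mul_of_nonneg_left b1 (by positivity)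

lemma exponentialBounds_greenExt {ν : ℂ} (hν : -(1 / 2) < ν.re) (hν' : ν.re < 1 / 2) (T : EReal)
    (M N : Matrix (Fin 2) (Fin 2) ℂ) (hN : N = 0) {α h : ℝ}
    (hα : α ∈ Ioo (0 : ℝ) (Real.pi / 2)) :
    ExponentialBounds T M N (domainD α h) (greenExt ν) (fun t => 1 / (4 * t)) 1 := by
  have hq : -1 < (ν - 1 / 2).re := by simp; linarith
  have hc := cos_pos_of_mem_Ioo hα
  have hM0 := laplaceBound_nonneg hq (ν - 1 / 2) hc
  have hM1 := laplaceDerivBound_nonneg hq hc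
  have hM2 := laplaceDerivTwoBound_nonneg hq hc
  set M0 := laplaceBound (ν - 1 / 2) (ν - 1 / 2) (Real.cos α)
  set M1 := laplaceDerivBound (ν - 1 / 2) (Real.cos α)
  set M2 := laplaceDerivTwoBound (ν - 1 / 2) (Real.cos α)
  have hsqrt : ContinuousOn (fun p : ℝ × ℝ => ‖kernelConst ν‖ * (Real.sqrt p.1)⁻¹)
      (timeInterval T ×ˢ {0}ᶜ) := by
    refine continuousOn_const.mul (ContinuousOn.inv₀ (by fun_prop) fun p hp => ?_)
    exact (Real.sqrt_pos.2 hp.1.1).ne'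
  have hzero : IsCoefficient T fun _ _ => 0 := ⟨fun _ _ _ _ => le_rfl, continuousOn_const⟩
  -- All growth coefficients are `0`, so the exponent `p = 1` is an arbitrary choice. The third
  -- amplitude is a sum because it has to serve the second space derivative and the time derivative
  -- at once.
  refine ⟨fun t _ => ‖kernelConst ν‖ * (Real.sqrt t)⁻¹ * M0,
    fun t x => ‖kernelConst ν‖ * (Real.sqrt t)⁻¹ * (M1 / |x|),
    fun t x => ‖kernelConst ν‖ * (Real.sqrt t)⁻¹ * (M2 / x ^ 2 + (M0 + M1) / t),
    fun _ _ => 0, fun _ _ => 0, fun _ _ => 0, ⟨⟨?_, ?_⟩, ⟨?_, ?_⟩, ⟨?_, ?_⟩, hzero, hzero, hzero⟩,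
    ?_, ?_, ?_⟩
  · intro t _ x _; positivity
  · exact hsqrt.mul continuousOn_const
  · intro t _ x _; positivity
  · refine hsqrt.mul (continuousOn_const.div (by fun_prop) fun p hp => ?_)
    exact abs_ne_zero.2 hp.2
  · intro t ht x _
    have := ht.1
    positivity
  · refine hsqrt.mul (ContinuousOn.add ?_ ?_)
    · exact continuousOn_const.div (by fun_prop) fun p hp => pow_ne_zero 2 hp.2
    · exact continuousOn_const.div (by fun_prop) fun p hp => hp.1.1.ne'
  · intro t ht x hx z hz
    have ht0 : 0 < t := ht.1
    obtain ⟨b1, b2, b3⟩ := norm_deriv_reduced_le hν hν' hα ht0 hx hz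
    simp only [zero_mul, Real.exp_zero, mul_one]
    refine ⟨norm_reduced_le hν hν' hα ht0 hz, b1, b2.trans ?_, b3.trans ?_⟩
    · exact mul_le_mul_of_nonneg_left (le_add_of_nonneg_right (by positivity)) (by positivity)
    · exact mul_le_mul_of_nonneg_left (le_add_of_nonneg_left (by positivity)) (by positivity)
  · intro x _
    refine ⟨isBoundedUnder_of_eventually_le (a := 2 * ‖kernelConst ν‖ * M0) ?_,
      isBoundedUnder_const⟩
    filter_upwards [self_mem_nhdsWithin] with t ht
    have hst : 0 < Real.sqrt t := Real.sqrt_pos.2 ht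
    -- The quotient `A₀/√a` is constant in `t`: both are multiples of `t^{-1/2}`.
    rw [sqrt_one_div_four_mul t]
    refine le_of_eq ?_
    field_simp
  · intro t _
    exact ⟨fun _ => ⟨isBoundedUnder_const, isBoundedUnder_const⟩, fun h => absurd hN h⟩

/-! ### Assembly. -/

theorem greenAssumption_greenFunction {lam : ℝ} (hlam : lam < 0) (T : EReal) {α : ℝ}
    (hα : α ∈ Ioo (0 : ℝ) (Real.pi / 2)) (h : ℝ) :
    GreenAssumption T (fun _ x => ((lam / x ^ 2 : ℝ) : ℂ)) 1 0 (domainD α h)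
      (greenFunction lam) := by
  have hν : -(1 / 2) < (order lam).re := by linarith [order_re_nonneg lam]
  have hν' := order_re_lt hlam
  refine ⟨greenExt (order lam), ?_, ?_, ?_, fun t => 1 / (4 * t), ?_, ?_, ?_, ?_, 1, by norm_num,
    exponentialBounds_greenExt hν hν' T 1 0 rfl hα⟩
  · intro t ht x hx
    refine ⟨fun y _ => greenExt_ofReal hlam ht.1, fun z hz => ?_, fun z hz => ?_⟩
    · exact (differentiableAt_greenExt hν hν' ht.1 hx
        (domainD_re_ne_zero hα hz)).continuousAt.continuousWithinAt
    · exact (differentiableAt_greenExt hν hν' ht.1 hx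
        (domainD_re_ne_zero hα (interior_subset hz))).differentiableWithinAt
  · intro z hz
    have hzr := domainD_re_ne_zero hα hz
    refine ⟨AC12_greenExt hν hν' T hzr, Eventually.of_forall fun p hp hp2 => ?_⟩
    obtain ⟨d1, d2, d3, e⟩ := greenExt_schroedinger hν hν' hp.1 hp2 hzr
    refine ⟨d1, d2, d3, e.trans ?_⟩
    rw [order_sq]
    push_cast
    ring
  · intro y _ t ht
    have hG : (fun x => greenFunction lam t x y) = fun x : ℝ => greenExt (order lam) t x y :=
      funext fun x => (greenExt_ofReal hlam ht.1).symm
    have hlim := tendsto_greenExt_zero (y := y) hν hν' ht.1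
    -- The last two zeros are placeholders: with `N = 0` no limit of the derivative enters the
    -- condition.
    refine ⟨0, 0, 0, 0, fun _ => ?_, fun h => absurd rfl h, by simp⟩
    rw [hG]
    exact ⟨hlim.mono_left (nhdsWithin_mono _ fun x hx => ne_of_gt hx),
      hlim.mono_left (nhdsWithin_mono _ fun x hx => ne_of_lt hx)⟩
  · refine AC_of_hasDerivAt (f' := fun t => -(1 / (4 * t ^ 2))) (ordConnected_timeInterval T)
      (isOpen_timeInterval T).measurableSet (fun t ht => ?_) ?_
    · have ht0 : t ≠ 0 := ht.1.ne'
      have h1 := ((hasDerivAt_id t).const_mul 4).inv (mul_ne_zero (by norm_num) ht0)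
      refine (h1.congr_deriv ?_).congr_of_eventuallyEq (Eventually.of_forall fun s => ?_)
      · simp only [id]
        field_simp
      · simp
    · refine (continuousOn_const.div (by fun_prop) fun t ht => ?_).neg
      have := ht.1.ne'
      positivity
  · intro t ht
    have := ht.1
    positivity
  · have h1 : Tendsto (fun t : ℝ => 4 * t) (𝓝[>] 0) (𝓝[>] 0) := by
      refine tendsto_nhdsWithin_iff.2 ⟨?_, ?_⟩
      · have hc : Continuous fun t : ℝ => 4 * t := by fun_prop
        simpa using (hc.tendsto 0).mono_left (nhdsWithin_le_nhds (s := Ioi 0))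
      · filter_upwards [self_mem_nhdsWithin] with t ht
        have : 0 < t := ht
        simpa using this
    exact h1.inv_tendsto_nhdsGT_zero.congr fun t => (one_div (4 * t)).symm
  · intro x hx
    refine (tendsto_greenExt_diagonal hν hν' hx).congr' ?_
    filter_upwards [self_mem_nhdsWithin] with t ht
    rw [greenExt_ofReal hlam ht]

end CentrifugalGreen

end

theorem proposition5p1 (lam : ℝ) (hlam : lam < 0) :
    (-(1 / 4) ≤ lam → (CentrifugalGreen.order lam).im = 0) ∧
    (lam < -(1 / 4) → (CentrifugalGreen.order lam).re = 0) ∧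
    ∀ (T : EReal), 0 < T → ∀ α ∈ Set.Ioo (0 : ℝ) (Real.pi / 2), ∀ h : ℝ, 0 < h →
      CentrifugalGreen.GreenAssumption T (fun _ x => ((lam / x ^ 2 : ℝ) : ℂ)) 1 0
        (CentrifugalGreen.domainD α h) (CentrifugalGreen.greenFunction lam) :=
  ⟨CentrifugalGreen.order_im_eq_zero, CentrifugalGreen.order_re_eq_zero,
    fun T _ _ hα h _ => CentrifugalGreen.greenAssumption_greenFunction hlam T hα h⟩
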